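/- Let $a,b>0$ and $\gamma,\widetilde\gamma\in\mathbb R$. Let $\Gamma_0$ be the infinite double-sided comb with internal vertices $x_j$ and boundary vertices $x_j^{\pm}$ ($j\in\mathbb Z$), in which $x_{j-1}$ and $x_j$ are joined by an edge of length $a$, and $x_j^-$ and $x_j^+$ are each joined to $x_j$ by an edge of length $b/2$. The edges are oriented from $x_{j-1}$ to $x_j$, from $x_j^-$ to $x_j$, and from $x_j$ to $x_j^+$. For $\theta\in[-\pi,\pi]$ let $\mathscr H^{\theta}_{\gamma,\widetilde\gamma}$ be the operator in $L^2(\Gamma_0)$ that acts as $-\frac{d^2}{dx^2}$ on every edge, on the functions $\psi\in L^2(\Gamma_0)$ that are of class $W^{2,2}$ on every edge, with $\psi''\in L^2(\Gamma_0)$, and that satisfy * at every $x_j$: $\psi$ is continuous, and the sum of the derivatives of $\psi$ along the four edges at $x_j$, taken in the direction away from $x_j$, equals $\gamma_j\,\psi(x_j)$, where $\gamma_0=\widetilde\gamma$ and $\gamma_j=\gamma$ for $j\neq0$; * for every $j$: $\psi(x_j^+)=e^{i\theta}\psi(x_j^-)$ and $\psi'(x_j^+)=e^{i\theta}\psi'(x_j^-)$.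 Let $\sigma_{\rm disc}$ denote the discrete spectrum, i.e. the set of eigenvalues of finite multiplicity that are isolated points of the spectrum, and put $$S_{\gamma,\widetilde\gamma}:=\bigcup_{\theta\in[-\pi,\pi]}\sigma_{\rm disc}\big(\mathscr H^{\theta}_{\gamma,\widetilde\gamma}\big).$$ **Positive energies.** For $k>0$ put $\mathcal G(k):=(\widetilde\gamma-\gamma)\frac{\sin ka}{2k}$ and let $\mathcal{BC}_k^{\pm}$ be the condition $$\sin kb\neq0\quad\text{and}\quad\left|\frac{\sin k(a+b)}{\sin kb}+\frac{\gamma\sin ka}{2k}\pm\sqrt{\Big((\widetilde\gamma-\gamma)\frac{\sin ka}{2k}\Big)^2+1}\,\right|\le\left|\frac{\sin ka}{\sin kb}\right|.$$ Then, for every $k>0$, $E=k^2$ belongs to $S_{\gamma,\widetilde\gamma}$ if and only if either $\mathcal{BC}_k^+$ and $\mathcal G(k)>0$ hold, or $\mathcal{BC}_k^-$ and $\mathcal G(k)<0$ hold. **Negative energies.** For $\kappa>0$ put $\widehat{\mathcal G}(\kappa):=(\widetilde\gamma-\gamma)\frac{\sinh\kappa a}{2\kappa}$ and let $\widehat{\mathcal{BC}}_\kappa^{\pm}$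 be the condition $$\left|\frac{\sinh\kappa(a+b)}{\sinh\kappa b}+\frac{\gamma\sinh\kappa a}{2\kappa}\pm\sqrt{\Big((\widetilde\gamma-\gamma)\frac{\sinh\kappa a}{2\kappa}\Big)^2+1}\,\right|\le\frac{\sinh\kappa a}{\sinh\kappa b}.$$ Then, for every $\kappa>0$, $E=-\kappa^2$ belongs to $S_{\gamma,\widetilde\gamma}$ if and only if either $\widehat{\mathcal{BC}}_\kappa^+$ and $\widehat{\mathcal G}(\kappa)>0$ hold, or $\widehat{\mathcal{BC}}_\kappa^-$ and $\widehat{\mathcal G}(\kappa)<0$ hold. -/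

import Mathlib

open MeasureTheory Set

noncomputable section

/-! ## Spectral notions for unbounded operators on a complex Hilbert space -/

section Spectral

variable {H : Type*} [NormedAddCommGroup H] [InnerProductSpace ℂ H]

/-- The resolvent set of an unbounded operator `A`: those `z` for which `A - z` is a bijection
of the domain of `A` onto the whole space whose inverse is a bounded everywhere defined
operator `R`. -/
def opResolventSet (A : H →ₗ.[ℂ] H) : Set ℂ :=
  {z | ∃ R : H →L[ℂ] H,
    (∀ y : H, ∃ h : R y ∈ A.domain, A ⟨R y, h⟩ - z • R y = y) ∧
    ∀ x : A.domain, R (A x - z • (x : H)) = x}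

/-- The spectrum of an unbounded operator. -/
def opSpectrum (A : H →ₗ.[ℂ] H) : Set ℂ := (opResolventSet A)ᶜ

/-- The eigenspace `ker (A - z)`, as a subspace of `H`. -/
def opEigenspace (A : H →ₗ.[ℂ] H) (z : ℂ) : Submodule ℂ H :=
  (LinearMap.ker (A.toFun - z • A.domain.subtype)).map A.domain.subtype

/-- The discrete spectrum (of a self-adjoint operator): the eigenvalues of finite multiplicity
that are isolated points of the spectrum. -/
def opDiscreteSpectrum (A : H →ₗ.[ℂ] H) : Set ℂ :=
  {z | opEigenspace A z ≠ ⊥ ∧ FiniteDimensional ℂ (opEigenspace A z) ∧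
    ∃ ε > 0, ∀ w ∈ opSpectrum A, dist w z < ε → w = z}

end Spectral

/-! ## The comb graph

The periodicity cell of the rectangular lattice in the direction of the perturbed chain is an
infinite double-sided comb with internal vertices `x_j` and boundary vertices `x_j^+`, `x_j^-`,
`j ∈ ℤ`.  Every edge is parametrized by `[0, length]`. -/

/-- The edges of the comb. -/
inductive CombEdge : Type
  /-- the edge of length `a` from `x_{j-1}` to `x_j` -/
  | rung (j : ℤ)
  /-- the edge of length `b / 2` from `x_j` to `x_j^+` -/
  | up (j : ℤ)
  /-- the edge of length `b / 2` from `x_j^-` to `x_j` -/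
  | down (j : ℤ)

/-- The length of an edge of the comb. -/
def CombEdge.length (a b : ℝ) : CombEdge → ℝ
  | .rung _ => a
  | .up _ => b / 2
  | .down _ => b / 2

/-- The space `L²(0, ℓ)`. -/
abbrev EdgeL2 (ℓ : ℝ) : Type := Lp ℂ 2 (volume.restrict (Ioc (0 : ℝ) ℓ))

/-- The Hilbert space `L²` of the comb: the Hilbert sum of the spaces `L²` of its edges. -/
abbrev CombL2 (a b : ℝ) : Type := lp (fun e : CombEdge => EdgeL2 (e.length a b)) 2

/-- `u` belongs to the Sobolev space `W^{2,2}(0, ℓ)`, with second derivative `w ∈ L²(0, ℓ)`: the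
function `f` is the `C¹` representative of `u` on `[0, ℓ]`, its derivative is `f'`, and `f'` is
absolutely continuous with derivative `w`. -/
structure IsW22Rep (ℓ : ℝ) (u w : EdgeL2 ℓ) (f f' : ℝ → ℂ) : Prop where
  ae_eq : u =ᵐ[volume.restrict (Ioc (0 : ℝ) ℓ)] f
  hasDeriv : ∀ x ∈ Icc 0 ℓ, HasDerivWithinAt f (f' x) (Icc 0 ℓ) x
  deriv_eq : ∀ x ∈ Icc 0 ℓ, f' x = f' 0 + ∫ t in (0 : ℝ)..x, w t

theorem EdgeL2.intervalIntegrable {ℓ : ℝ} (w : EdgeL2 ℓ) {x : ℝ} (hx : x ∈ Icc 0 ℓ) :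
    IntervalIntegrable w volume 0 x := by
  have h : Integrable w (volume.restrict (Ioc (0 : ℝ) ℓ)) :=
    (Lp.memLp w).integrable (by norm_num)
  rw [intervalIntegrable_iff_integrableOn_Ioc_of_le hx.1]
  exact h.mono_measure (Measure.restrict_mono (Ioc_subset_Ioc_right hx.2) le_rfl)

theorem EdgeL2.integral_congr {ℓ : ℝ} {w : EdgeL2 ℓ} {g : ℝ → ℂ}
    (h : w =ᵐ[volume.restrict (Ioc (0 : ℝ) ℓ)] g) {x : ℝ} (hx : x ∈ Icc 0 ℓ) :
    ∫ t in (0 : ℝ)..x, w t = ∫ t in (0 : ℝ)..x, g t := by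
  rw [intervalIntegral.integral_of_le hx.1, intervalIntegral.integral_of_le hx.1]
  exact integral_congr_ae
    (ae_mono (Measure.restrict_mono (Ioc_subset_Ioc_right hx.2) le_rfl) h)

theorem IsW22Rep.zero (ℓ : ℝ) : IsW22Rep ℓ 0 0 0 0 where
  ae_eq := Lp.coeFn_zero _ _ _
  hasDeriv x _ := hasDerivWithinAt_const x _ (0 : ℂ)
  deriv_eq x hx := by
    rw [EdgeL2.integral_congr (Lp.coeFn_zero ℂ 2 _) hx]
    simp

theorem IsW22Rep.add {ℓ : ℝ} {u w u₁ w₁ : EdgeL2 ℓ} {f f' f₁ f₁' : ℝ → ℂ}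
    (h : IsW22Rep ℓ u w f f') (h₁ : IsW22Rep ℓ u₁ w₁ f₁ f₁') :
    IsW22Rep ℓ (u + u₁) (w + w₁) (f + f₁) (f' + f₁') where
  ae_eq := (Lp.coeFn_add u u₁).trans (h.ae_eq.add h₁.ae_eq)
  hasDeriv x hx := (h.hasDeriv x hx).add (h₁.hasDeriv x hx)
  deriv_eq x hx := by
    rw [EdgeL2.integral_congr (Lp.coeFn_add w w₁) hx]
    simp only [Pi.add_apply]
    rw [intervalIntegral.integral_add (w.intervalIntegrable hx) (w₁.intervalIntegrable hx),
      h.deriv_eq x hx, h₁.deriv_eq x hx]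
    ring

theorem IsW22Rep.smul {ℓ : ℝ} {u w : EdgeL2 ℓ} {f f' : ℝ → ℂ} (c : ℂ)
    (h : IsW22Rep ℓ u w f f') : IsW22Rep ℓ (c • u) (c • w) (c • f) (c • f') where
  ae_eq := (Lp.coeFn_smul c u).trans (h.ae_eq.const_smul c)
  hasDeriv x hx := (h.hasDeriv x hx).const_smul c
  deriv_eq x hx := by
    rw [EdgeL2.integral_congr (Lp.coeFn_smul c w) hx]
    simp only [Pi.smul_apply]
    rw [intervalIntegral.integral_smul, h.deriv_eq x hx, smul_add]

/-- The second derivative of the zero function vanishes. -/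
theorem IsW22Rep.eq_zero {ℓ : ℝ} (hℓ : 0 < ℓ) {w : EdgeL2 ℓ} {f f' : ℝ → ℂ}
    (h : IsW22Rep ℓ 0 w f f') : w = 0 := by
  have hcont : ContinuousOn f (Icc 0 ℓ) := fun x hx => (h.hasDeriv x hx).continuousWithinAt
  have hf0 : EqOn f 0 (Icc 0 ℓ) := by
    have h1 : f =ᵐ[volume.restrict (Ioc (0 : ℝ) ℓ)] 0 :=
      h.ae_eq.symm.trans (Lp.coeFn_zero _ _ _)
    rw [restrict_Ioc_eq_restrict_Icc] at h1
    exact Measure.eqOn_Icc_of_ae_eq volume hℓ.ne h1 hcont continuousOn_const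
  have hf'0 : ∀ x ∈ Icc 0 ℓ, f' x = 0 := fun x hx => by
    have h2 : HasDerivWithinAt f 0 (Icc 0 ℓ) x :=
      (hasDerivWithinAt_const x _ (0 : ℂ)).congr (fun y hy => hf0 hy) (hf0 hx)
    exact (uniqueDiffOn_Icc hℓ x hx).eq_deriv _ (h.hasDeriv x hx) h2
  have hint : ∀ x ∈ Icc 0 ℓ, ∫ t in (0 : ℝ)..x, w t = 0 := fun x hx => by
    have h3 := h.deriv_eq x hx
    rw [hf'0 x hx, hf'0 0 ⟨le_rfl, hℓ.le⟩, zero_add] at h3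
    exact h3.symm
  have hw := (w.intervalIntegrable ⟨hℓ.le, le_rfl⟩).ae_hasDerivAt_integral
  have hend : ∀ᵐ x : ℝ, x ≠ ℓ := Measure.ae_ne volume ℓ
  rw [Lp.eq_zero_iff_ae_eq_zero]
  refine (ae_restrict_iff' measurableSet_Ioc).2 ?_
  filter_upwards [hw, hend] with x hx hxℓ hmem
  have hd := hx (by rw [uIcc_of_le hℓ.le]; exact ⟨hmem.1.le, hmem.2⟩) 0 left_mem_uIcc
  have hz : HasDerivAt (fun y : ℝ => ∫ t in (0 : ℝ)..y, w t) 0 x := by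
    refine (hasDerivAt_const x (0 : ℂ)).congr_of_eventuallyEq ?_
    filter_upwards [Icc_mem_nhds hmem.1 (lt_of_le_of_ne hmem.2 hxℓ)] with y hy
    exact hint y hy
  exact hd.unique hz

/-! ## The fiber operators -/

/-- The vertex conditions for an edgewise `C¹` function `f` with derivative `f'`: at the internal
vertices `x_j` the function is continuous and satisfies the `δ`-coupling condition, of strength
`γt` at `x_0` and `γ` at all the other internal vertices (the outgoing derivatives sum up to the
strength times the value); at the boundary vertices the function is quasiperiodic, with the
phase `exp (i θ)`. -/
structure CombVertexConditions (a b γ γt θ : ℝ) (f f' : CombEdge → ℝ → ℂ) : Prop where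
  cont_rung : ∀ j, f (.rung j) a = f (.up j) 0
  cont_rung_succ : ∀ j, f (.rung (j + 1)) 0 = f (.up j) 0
  cont_down : ∀ j, f (.down j) (b / 2) = f (.up j) 0
  delta : ∀ j, f' (.rung (j + 1)) 0 - f' (.rung j) a + f' (.up j) 0 - f' (.down j) (b / 2)
    = ((if j = 0 then γt else γ : ℝ) : ℂ) * f (.up j) 0
  floquet : ∀ j, f (.up j) (b / 2) = Complex.exp (Complex.I * θ) * f (.down j) 0
  floquet_deriv : ∀ j, f' (.up j) (b / 2) = Complex.exp (Complex.I * θ) * f' (.down j) 0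

/-- The graph of the fiber operator: the pairs `(u, -u'')` in which `u` is edgewise of class
`W^{2,2}`, `u` and `u''` are square integrable over the comb, and `u` satisfies the vertex
conditions. (The edge lengths are bounded from below, so that `u'` is then square integrable over
the comb as well.) -/
def combGraph (a b γ γt θ : ℝ) : Submodule ℂ (CombL2 a b × CombL2 a b) where
  carrier := {p | ∃ f f' : CombEdge → ℝ → ℂ,
    (∀ e, IsW22Rep (e.length a b) (p.1 e) (-p.2 e) (f e) (f' e)) ∧
    CombVertexConditions a b γ γt θ f f'}
  zero_mem' := by
    refine ⟨0, 0, fun e => ?_, ?_⟩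
    · simpa using IsW22Rep.zero (e.length a b)
    · constructor <;> simp
  add_mem' := by
    rintro p q ⟨f, f', hf, hv⟩ ⟨g, g', hg, hw⟩
    refine ⟨f + g, f' + g', fun e => ?_, ?_⟩
    · have := (hf e).add (hg e)
      rw [← neg_add] at this
      exact this
    · constructor <;> intro j <;> simp only [Pi.add_apply]
      · rw [hv.cont_rung, hw.cont_rung]
      · rw [hv.cont_rung_succ, hw.cont_rung_succ]
      · rw [hv.cont_down, hw.cont_down]
      · linear_combination hv.delta j + hw.delta j
      · rw [hv.floquet, hw.floquet, mul_add]
      · rw [hv.floquet_deriv, hw.floquet_deriv, mul_add]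
  smul_mem' := by
    rintro c p ⟨f, f', hf, hv⟩
    refine ⟨c • f, c • f', fun e => ?_, ?_⟩
    · have := (hf e).smul c
      rw [smul_neg] at this
      exact this
    · constructor <;> intro j <;> simp only [Pi.smul_apply, smul_eq_mul]
      · rw [hv.cont_rung]
      · rw [hv.cont_rung_succ]
      · rw [hv.cont_down]
      · linear_combination c * hv.delta j
      · rw [hv.floquet]; ring
      · rw [hv.floquet_deriv]; ring

/-- The fiber operator at quasimomentum `θ`: minus the second derivative on the edges of the
comb, with `δ`-couplings of strength `γt` at `x_0` and `γ` at the other internal vertices, and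
`θ`-quasiperiodic conditions at the boundary vertices. -/
def combHamiltonian (a b γ γt θ : ℝ) : CombL2 a b →ₗ.[ℂ] CombL2 a b :=
  (combGraph a b γ γt θ).toLinearPMap

theorem combGraph_single_valued {a b : ℝ} (ha : 0 < a) (hb : 0 < b) (γ γt θ : ℝ)
    (p : CombL2 a b × CombL2 a b) (hp : p ∈ combGraph a b γ γt θ) (h0 : p.1 = 0) : p.2 = 0 := by
  obtain ⟨f, f', hf, -⟩ := hp
  ext1
  funext e
  have hpos : 0 < e.length a b := by cases e <;> simp [CombEdge.length, ha, hb]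
  have h := hf e
  rw [h0] at h
  exact neg_eq_zero.mp (IsW22Rep.eq_zero hpos h)

/-- The graph of the fiber operator is indeed `combGraph`. -/
theorem combHamiltonian_graph {a b : ℝ} (ha : 0 < a) (hb : 0 < b) (γ γt θ : ℝ) :
    (combHamiltonian a b γ γt θ).graph = combGraph a b γ γt θ :=
  Submodule.toLinearPMap_graph_eq _ (combGraph_single_valued ha hb γ γt θ)

/-- The set of energies `S = ⋃_{θ ∈ [-π, π]} σ_disc (H^θ)`. -/
def bandSet (a b γ γt : ℝ) : Set ℝ :=
  {E | ∃ θ ∈ Icc (-Real.pi) Real.pi,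
    (E : ℂ) ∈ opDiscreteSpectrum (combHamiltonian a b γ γt θ)}

/-! ## The band conditions -/

/-- `(γt - γ) sin (k a) / (2 k)` -/
def bandG (a γ γt k : ℝ) : ℝ := (γt - γ) * (Real.sin (k * a) / (2 * k))

/-- The condition with the sign `+`; it includes that its fractions are defined. -/
def BCPlus (a b γ γt k : ℝ) : Prop :=
  Real.sin (k * b) ≠ 0 ∧
  |Real.sin (k * (a + b)) / Real.sin (k * b) + γ * Real.sin (k * a) / (2 * k)
      + √(((γt - γ) * (Real.sin (k * a) / (2 * k))) ^ 2 + 1)|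
    ≤ |Real.sin (k * a) / Real.sin (k * b)|

/-- The condition with the sign `-`; it includes that its fractions are defined. -/
def BCMinus (a b γ γt k : ℝ) : Prop :=
  Real.sin (k * b) ≠ 0 ∧
  |Real.sin (k * (a + b)) / Real.sin (k * b) + γ * Real.sin (k * a) / (2 * k)
      - √(((γt - γ) * (Real.sin (k * a) / (2 * k))) ^ 2 + 1)|
    ≤ |Real.sin (k * a) / Real.sin (k * b)|

/-- `(γt - γ) sinh (κ a) / (2 κ)` -/
def bandGNeg (a γ γt κ : ℝ) : ℝ := (γt - γ) * (Real.sinh (κ * a) / (2 * κ))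

/-- The hyperbolic condition with the sign `+`. -/
def BCPlusNeg (a b γ γt κ : ℝ) : Prop :=
  |Real.sinh (κ * (a + b)) / Real.sinh (κ * b) + γ * Real.sinh (κ * a) / (2 * κ)
      + √(((γt - γ) * (Real.sinh (κ * a) / (2 * κ))) ^ 2 + 1)|
    ≤ Real.sinh (κ * a) / Real.sinh (κ * b)

/-- The hyperbolic condition with the sign `-`. -/
def BCMinusNeg (a b γ γt κ : ℝ) : Prop :=
  |Real.sinh (κ * (a + b)) / Real.sinh (κ * b) + γ * Real.sinh (κ * a) / (2 * κ)
      - √(((γt - γ) * (Real.sinh (κ * a) / (2 * κ))) ^ 2 + 1)|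
    ≤ Real.sinh (κ * a) / Real.sinh (κ * b)

end

noncomputable section

/-! ## Integration by parts on an edge -/

/-! On an edge, solutions of `-f'' = E f` are combinations of `C` and `S` (cosine and sine, or their
hyperbolic versions). When `S a` and `S b` are nonzero, the Floquet condition eliminates each
vertical pair of edges, and the rungs express the remaining derivatives through the vertex values `ψ
j`. The delta conditions then become `ψ (j+1) + ψ (j-1) = 2 (M + G δ_{j0}) ψ j` with `M = C a + S a
(C b - cos θ) / S b + γ S a / 2` and `G = (γt - γ) S a / 2`.

A decaying solution is `λ ^ |j| ψ 0` with `λ + λ⁻¹ = 2 M`, and the equation at `0` forces `λ = M +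
G`. Hence `λ⁻¹ = M - G`, so that `M² = G² + 1`, and `|λ| < 1` amounts to `M G < 0`
(`eq_zero_or_of_recurrence`). In the degenerate cases `S a = 0` or `S b = 0`, an eigenspace is
either trivial or of infinite dimension, the latter because of eigenfunctions localized near single
edges (`of_mem_opDiscreteSpectrum`).

Conversely, the geometric sequence yields an eigenfunction `φ`. For isolatedness it suffices that
the range of the operator minus `E` contains the orthogonal complement of `φ`
(`mem_opDiscreteSpectrum_of_symmetric`). For `y ⊥ φ`, the equation is first solved with the
unperturbed coupling `γ` at `x_0`, which is possible because `|M| > 1`. Green's identity against `φ`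
then makes the solution vanish at `x_0`, so it satisfies the perturbed condition too
(`mem_opDiscreteSpectrum`).

Finally `M = A - ρ cos θ`, and `M` must equal `√(G² + 1)` with the sign opposite to that of `G`.
Such a `θ` exists exactly when `|A ± √(G² + 1)| ≤ |ρ|` (`exists_band_parameter_iff`). -/

theorem absolutelyContinuousOnInterval_integral {w : ℝ → ℂ} {a b : ℝ}
    (hw : IntervalIntegrable w volume a b) :
    AbsolutelyContinuousOnInterval (fun x => ∫ t in a..x, w t) a b := by
  -- Increments of the complex primitive are dominated by those of the primitive of `‖w‖`, so the
  -- real-valued case suffices.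
  have hN := hw.norm.absolutelyContinuousOnInterval_intervalIntegral (c := a) left_mem_uIcc
  rw [absolutelyContinuousOnInterval_iff] at hN ⊢
  intro ε hε
  obtain ⟨δ, hδ, h⟩ := hN ε hε
  refine ⟨δ, hδ, fun E hE hE' => lt_of_le_of_lt (Finset.sum_le_sum fun i hi => ?_) (h E hE hE')⟩
  have hm := hE.1 i hi
  have h1 : IntervalIntegrable w volume a (E.2 i).1 :=
    hw.mono_set (uIcc_subset_uIcc left_mem_uIcc hm.1)
  have h2 : IntervalIntegrable w volume a (E.2 i).2 :=
    hw.mono_set (uIcc_subset_uIcc left_mem_uIcc hm.2)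
  rw [dist_comm, dist_comm (∫ t in a..(E.2 i).1, ‖w t‖), dist_eq_norm, dist_eq_norm,
    intervalIntegral.integral_interval_sub_left h2 h1,
    intervalIntegral.integral_interval_sub_left h2.norm h1.norm, Real.norm_eq_abs]
  exact intervalIntegral.norm_integral_le_abs_integral_norm

/-- Integration by parts for two functions given as primitives of integrable functions. -/
theorem integral_primitive_mul_add {g G : ℝ → ℂ} {a b : ℝ} (c C : ℂ)
    (hg : IntervalIntegrable g volume a b) (hG : IntervalIntegrable G volume a b) :
    ∫ x in a..b, (g x * (C + ∫ t in a..x, G t) + (c + ∫ t in a..x, g t) * G x) =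
      (c + ∫ t in a..b, g t) * (C + ∫ t in a..b, G t) - c * C := by
  have hconst : ∀ z : ℂ, AbsolutelyContinuousOnInterval (fun _ : ℝ => z) a b := fun z =>
    (LipschitzWith.const z).lipschitzOnWith.absolutelyContinuousOnInterval
  have hf : AbsolutelyContinuousOnInterval (fun x => c + ∫ t in a..x, g t) a b :=
    (hconst c).add (absolutelyContinuousOnInterval_integral hg)
  have hF : AbsolutelyContinuousOnInterval (fun x => C + ∫ t in a..x, G t) a b :=
    (hconst C).add (absolutelyContinuousOnInterval_integral hG)
  have hint : IntervalIntegrable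
      (fun x => g x * (C + ∫ t in a..x, G t) + (c + ∫ t in a..x, g t) * G x) volume a b :=
    (hg.mul_continuousOn hF.continuousOn).add (hG.continuousOn_mul hf.continuousOn)
  -- The product minus the primitive of its formal derivative is absolutely continuous with
  -- derivative zero almost everywhere, hence constant.
  have hD := (hf.smul hF).sub (absolutelyContinuousOnInterval_integral hint)
  obtain ⟨K, hK⟩ := hD.const_of_ae_hasDerivAt_zero (by
    filter_upwards [hg.ae_hasDerivAt_integral, hG.ae_hasDerivAt_integral,
      hint.ae_hasDerivAt_integral] with x h1 h2 h3 hx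
    have e1 := (h1 hx a left_mem_uIcc).const_add c
    have e2 := (h2 hx a left_mem_uIcc).const_add C
    have e3 := (e1.mul e2).sub (h3 hx a left_mem_uIcc)
    rw [sub_self] at e3
    exact e3)
  have ha := hK a left_mem_uIcc
  have hb := hK b right_mem_uIcc
  simp only [Pi.sub_apply, smul_eq_mul, Pi.mul_apply, intervalIntegral.integral_same,
    add_zero, sub_zero] at ha hb
  rw [← ha] at hb
  linear_combination -hb

/-- `f` is `C¹` on `[0, ℓ]` with derivative `f'`, a primitive of the integrable function `w`. -/
structure IsW21On (ℓ : ℝ) (w f f' : ℝ → ℂ) : Prop where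
  integrable : IntervalIntegrable w volume 0 ℓ
  hasDeriv : ∀ x ∈ Icc 0 ℓ, HasDerivWithinAt f (f' x) (Icc 0 ℓ) x
  deriv_eq : ∀ x ∈ Icc 0 ℓ, f' x = f' 0 + ∫ t in (0 : ℝ)..x, w t

namespace IsW21On

variable {ℓ : ℝ} {w f f' z g g' : ℝ → ℂ}

theorem continuousOn (h : IsW21On ℓ w f f') : ContinuousOn f (Icc 0 ℓ) :=
  fun x hx => (h.hasDeriv x hx).continuousWithinAt

theorem continuousOn_deriv (h : IsW21On ℓ w f f') (hℓ : 0 ≤ ℓ) : ContinuousOn f' (Icc 0 ℓ) := by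
  have := (absolutelyContinuousOnInterval_integral h.integrable).continuousOn
  rw [uIcc_of_le hℓ] at this
  exact (continuousOn_const.add this).congr h.deriv_eq

theorem intervalIntegrable_deriv (h : IsW21On ℓ w f f') {x : ℝ} (hx : x ∈ Icc 0 ℓ) :
    IntervalIntegrable f' volume 0 x := by
  refine ContinuousOn.intervalIntegrable ?_
  rw [uIcc_of_le hx.1]
  exact (h.continuousOn_deriv (hx.1.trans hx.2)).mono (Icc_subset_Icc_right hx.2)

theorem eq_add_integral (h : IsW21On ℓ w f f') {x : ℝ} (hx : x ∈ Icc 0 ℓ) :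
    f x = f 0 + ∫ t in (0 : ℝ)..x, f' t := by
  rw [intervalIntegral.integral_eq_sub_of_hasDeriv_right_of_le hx.1
    (h.continuousOn.mono (Icc_subset_Icc_right hx.2)) (fun t ht => ?_)
    (h.intervalIntegrable_deriv hx)]
  · ring
  · exact ((h.hasDeriv t ⟨ht.1.le, ht.2.le.trans hx.2⟩).hasDerivAt
      (Icc_mem_nhds ht.1 (ht.2.trans_le hx.2))).hasDerivWithinAt

theorem mono (h : IsW21On ℓ w f f') {x : ℝ} (hx : x ∈ Icc 0 ℓ) : IsW21On x w f f' where
  integrable := h.integrable.mono_set (by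
    rw [uIcc_of_le hx.1, uIcc_of_le (hx.1.trans hx.2)]; exact Icc_subset_Icc_right hx.2)
  hasDeriv t ht := (h.hasDeriv t ⟨ht.1, ht.2.trans hx.2⟩).mono (Icc_subset_Icc_right hx.2)
  deriv_eq t ht := h.deriv_eq t ⟨ht.1, ht.2.trans hx.2⟩

theorem of_hasDerivAt (hf : ∀ x, HasDerivAt f (f' x) x) (hf' : ∀ x, HasDerivAt f' (w x) x)
    (hw : Continuous w) (ℓ : ℝ) : IsW21On ℓ w f f' where
  integrable := hw.intervalIntegrable _ _
  hasDeriv x _ := (hf x).hasDerivWithinAt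
  deriv_eq x _ := by
    rw [intervalIntegral.integral_eq_sub_of_hasDerivAt (fun t _ => hf' t)
      (hw.intervalIntegrable _ _)]
    ring

theorem conj (h : IsW21On ℓ w f f') :
    IsW21On ℓ (fun x => star (w x)) (fun x => star (f x)) (fun x => star (f' x)) where
  integrable := by
    have := h.integrable
    exact ⟨Complex.conjCLE.toContinuousLinearMap.integrable_comp this.1,
      Complex.conjCLE.toContinuousLinearMap.integrable_comp this.2⟩
  hasDeriv x hx := (h.hasDeriv x hx).star
  deriv_eq x hx := by
    rw [h.deriv_eq x hx, star_add]
    congr 1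
    have := Complex.conjCLE.toContinuousLinearMap.intervalIntegral_comp_comm
      (h.mono hx).integrable
    exact this.symm

/-- Green's identity on an interval. -/
theorem green (hg : IsW21On ℓ z g g') (hf : IsW21On ℓ w f f') (hℓ : 0 ≤ ℓ) :
    ∫ t in (0 : ℝ)..ℓ, (g t * w t - z t * f t) =
      (g ℓ * f' ℓ - g' ℓ * f ℓ) - (g 0 * f' 0 - g' 0 * f 0) := by
  have hm : ℓ ∈ Icc 0 ℓ := ⟨hℓ, le_rfl⟩
  -- One integration by parts; subtracting the version with the two functions exchanged cancels `g'
  -- * f'`.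
  have key : ∀ {z g g' w f f' : ℝ → ℂ}, IsW21On ℓ z g g' → IsW21On ℓ w f f' →
      ∫ t in (0 : ℝ)..ℓ, (g' t * f' t + g t * w t) = g ℓ * f' ℓ - g 0 * f' 0 := by
    intro z g g' w f f' hg hf
    have := integral_primitive_mul_add (g 0) (f' 0) (hg.intervalIntegrable_deriv hm) hf.integrable
    rw [← hg.eq_add_integral hm, ← hf.deriv_eq ℓ hm] at this
    rw [← this]
    refine intervalIntegral.integral_congr fun t ht => ?_
    rw [uIcc_of_le hℓ] at ht
    simp only [← hg.eq_add_integral ht, ← hf.deriv_eq t ht]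
  have hint : ∀ {z g g' w f f' : ℝ → ℂ}, IsW21On ℓ z g g' → IsW21On ℓ w f f' →
      IntervalIntegrable (fun t => g' t * f' t + g t * w t) volume 0 ℓ := by
    intro z g g' w f f' hg hf
    refine ((hg.intervalIntegrable_deriv hm).mul_continuousOn ?_).add
      (hf.integrable.continuousOn_mul ?_) <;> rw [uIcc_of_le hℓ]
    exacts [hf.continuousOn_deriv hℓ, hg.continuousOn]
  have h1 := key hg hf
  have h2 := key hf hg
  have h3 := intervalIntegral.integral_sub (hint hg hf) (hint hf hg)
  rw [h1, h2] at h3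
  rw [show g ℓ * f' ℓ - g' ℓ * f ℓ - (g 0 * f' 0 - g' 0 * f 0) =
    g ℓ * f' ℓ - g 0 * f' 0 - (f ℓ * g' ℓ - f 0 * g' 0) by ring, ← h3]
  refine intervalIntegral.integral_congr fun t _ => ?_
  ring

end IsW21On

theorem IsW22Rep.isW21On {ℓ : ℝ} {u w : EdgeL2 ℓ} {f f' : ℝ → ℂ} (h : IsW22Rep ℓ u w f f')
    (hℓ : 0 ≤ ℓ) : IsW21On ℓ w f f' :=
  ⟨w.intervalIntegrable ⟨hℓ, le_rfl⟩, h.hasDeriv, h.deriv_eq⟩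

/-! ## Solutions on an edge -/

/-- `C` and `S` are the solutions of `-f'' = E f` with initial data `(1, 0)` and `(0, 1)`. -/
structure IsFundamentalSystem (E : ℝ) (C S : ℝ → ℝ) : Prop where
  C_zero : C 0 = 1
  S_zero : S 0 = 0
  hasDerivAt_C : ∀ x, HasDerivAt C (-E * S x) x
  hasDerivAt_S : ∀ x, HasDerivAt S (C x) x
  sq_add_sq : ∀ x, C x ^ 2 + E * S x ^ 2 = 1
  S_two_mul : ∀ x, S (2 * x) = 2 * S x * C x
  C_two_mul : ∀ x, C (2 * x) = C x ^ 2 - E * S x ^ 2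

/-- A continuous weight is bounded on `[0, ℓ]`, and `L²` embeds in `L¹` on a bounded interval. The
constant depends only on `ℓ` and `q`, which allows summation over all edges of one length. -/
theorem exists_norm_integral_mul_le (ℓ : ℝ) {q : ℝ → ℂ} (hq : Continuous q) :
    ∃ K : ℝ, 0 ≤ K ∧ ∀ (u : EdgeL2 ℓ), ∀ x ∈ Icc 0 ℓ,
      ‖∫ t in (0 : ℝ)..x, q t * u t‖ ≤ K * ‖u‖ := by
  obtain ⟨B, hB⟩ := isCompact_Icc.exists_bound_of_continuousOn (s := Icc 0 ℓ) hq.continuousOn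
  set μ := volume.restrict (Ioc (0 : ℝ) ℓ) with hμ
  set c := (μ univ ^ (1 / (1 : ENNReal).toReal - 1 / (2 : ENNReal).toReal)) with hc
  have hcfin : c ≠ ⊤ := by
    refine ENNReal.rpow_ne_top_of_nonneg (by norm_num) (measure_ne_top _ _)
  refine ⟨|B| * c.toReal, by positivity, fun u x hx => ?_⟩
  have hu : Integrable u μ := (Lp.memLp u).integrable (by norm_num)
  have h1 : ∫ t, ‖u t‖ ∂μ ≤ c.toReal * ‖u‖ := by
    rw [integral_norm_eq_lintegral_enorm hu.aestronglyMeasurable, ← eLpNorm_one_eq_lintegral_enorm,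
      Lp.norm_def, ← ENNReal.toReal_mul]
    refine ENNReal.toReal_mono (ENNReal.mul_ne_top hcfin (Lp.eLpNorm_ne_top u)) ?_
    rw [mul_comm]
    exact eLpNorm_le_eLpNorm_mul_rpow_measure_univ (by norm_num) hu.aestronglyMeasurable
  have h2 : ∀ᵐ t ∂μ, ‖q t * u t‖ ≤ |B| * ‖u t‖ := by
    refine (ae_restrict_iff' measurableSet_Ioc).2 (Filter.Eventually.of_forall fun t ht => ?_)
    rw [norm_mul]
    gcongr
    exact (hB t ⟨ht.1.le, ht.2⟩).trans (le_abs_self B)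
  rw [intervalIntegral.integral_of_le hx.1]
  calc ‖∫ t in Ioc 0 x, q t * u t‖ ≤ ∫ t in Ioc 0 x, |B| * ‖u t‖ := by
        refine norm_integral_le_of_norm_le ?_
          (ae_mono (Measure.restrict_mono (Ioc_subset_Ioc_right hx.2) le_rfl) h2)
        exact (hu.norm.const_mul _).mono_measure
          (Measure.restrict_mono (Ioc_subset_Ioc_right hx.2) le_rfl)
    _ ≤ ∫ t, |B| * ‖u t‖ ∂μ := by
        refine integral_mono_measure (Measure.restrict_mono (Ioc_subset_Ioc_right hx.2) le_rfl)
          (Filter.Eventually.of_forall fun t => by simp only [Pi.zero_apply]; positivity)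
          (hu.norm.const_mul _)
    _ = |B| * ∫ t, ‖u t‖ ∂μ := integral_const_mul _ _
    _ ≤ |B| * c.toReal * ‖u‖ := by rw [mul_assoc]; gcongr

/-- Point evaluations at the initial vertex are bounded by the graph norm. -/
theorem exists_norm_trace_le {ℓ : ℝ} (hℓ : 0 < ℓ) :
    ∃ K : ℝ, 0 ≤ K ∧ ∀ (u w : EdgeL2 ℓ) (f f' : ℝ → ℂ), IsW22Rep ℓ u w f f' →
      ‖f 0‖ ≤ K * (‖u‖ + ‖w‖) ∧ ‖f' 0‖ ≤ K * (‖u‖ + ‖w‖) := by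
  -- A test function vanishing to first order at `ℓ` leaves only the boundary term at `0` in Green's
  -- identity.
  have hq : ∀ (q q' q'' : ℝ → ℝ), (∀ x, HasDerivAt q (q' x) x) → (∀ x, HasDerivAt q' (q'' x) x) →
      Continuous q'' → q ℓ = 0 → q' ℓ = 0 →
      ∃ K : ℝ, 0 ≤ K ∧ ∀ (u w : EdgeL2 ℓ) (f f' : ℝ → ℂ), IsW22Rep ℓ u w f f' →
        ‖(q 0 : ℂ) * f' 0 - q' 0 * f 0‖ ≤ K * (‖u‖ + ‖w‖) := by
    intro q q' q'' h1 h2 h3 h4 h5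
    have c1 : Continuous fun x => (q x : ℂ) := Complex.continuous_ofReal.comp
      (continuous_iff_continuousAt.2 fun x => (h1 x).continuousAt)
    have c3 : Continuous fun x => (q'' x : ℂ) := Complex.continuous_ofReal.comp h3
    obtain ⟨K₁, hK₁, hb₁⟩ := exists_norm_integral_mul_le ℓ c1
    obtain ⟨K₂, hK₂, hb₂⟩ := exists_norm_integral_mul_le ℓ c3
    refine ⟨K₁ + K₂, by positivity, fun u w f f' h => ?_⟩
    have hm : ℓ ∈ Icc 0 ℓ := ⟨hℓ.le, le_rfl⟩
    have hg := (IsW21On.of_hasDerivAt (fun x => (h1 x).ofReal_comp) (fun x => (h2 x).ofReal_comp)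
      c3 ℓ).green (h.isW21On hℓ.le) hℓ.le
    rw [h4, h5] at hg
    have hu : ∫ t in (0 : ℝ)..ℓ, ((q t : ℂ) * w t - q'' t * f t) =
        (∫ t in (0 : ℝ)..ℓ, (q t : ℂ) * w t) - ∫ t in (0 : ℝ)..ℓ, (q'' t : ℂ) * u t := by
      rw [← intervalIntegral.integral_sub ((w.intervalIntegrable hm).continuousOn_mul
        c1.continuousOn) ((u.intervalIntegrable hm).continuousOn_mul c3.continuousOn)]
      rw [intervalIntegral.integral_of_le hℓ.le, intervalIntegral.integral_of_le hℓ.le]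
      refine integral_congr_ae ?_
      filter_upwards [h.ae_eq] with t ht
      rw [ht]
    rw [hu] at hg
    have : (q 0 : ℂ) * f' 0 - q' 0 * f 0 = (∫ t in (0 : ℝ)..ℓ, (q'' t : ℂ) * u t) -
        ∫ t in (0 : ℝ)..ℓ, (q t : ℂ) * w t := by
      push_cast at hg
      linear_combination hg
    rw [this]
    refine (norm_sub_le _ _).trans ((add_le_add (hb₂ u ℓ hm) (hb₁ w ℓ hm)).trans ?_)
    nlinarith [norm_nonneg u, norm_nonneg w]
  have d1 : ∀ x : ℝ, HasDerivAt (fun x => (ℓ - x) ^ 2) (-2 * (ℓ - x)) x := fun x => by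
    convert! ((hasDerivAt_id' x).const_sub ℓ).pow 2 using 1; ring
  have d1' : ∀ x : ℝ, HasDerivAt (fun x => -2 * (ℓ - x)) 2 x := fun x => by
    convert! ((hasDerivAt_id' x).const_sub ℓ).const_mul (-2) using 1; ring
  have d2 : ∀ x : ℝ, HasDerivAt (fun x => x * (ℓ - x) ^ 2)
      ((ℓ - x) ^ 2 + x * (-2 * (ℓ - x))) x := fun x => by
    convert! (hasDerivAt_id' x).mul (d1 x) using 1; ring
  have d2' : ∀ x : ℝ, HasDerivAt (fun x => (ℓ - x) ^ 2 + x * (-2 * (ℓ - x)))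
      (6 * x - 4 * ℓ) x := fun x => by
    convert! (d1 x).add ((hasDerivAt_id' x).mul (d1' x)) using 1; ring
  -- The test function `x (ℓ - x)²` isolates `f 0`. Then `(ℓ - x)²`, whose boundary term is `ℓ² f' 0
  -- + 2 ℓ f 0`, gives `f' 0`.
  obtain ⟨K₁, hK₁, hb₁⟩ := hq _ _ _ d1 d1' continuous_const (by ring) (by ring)
  obtain ⟨K₂, hK₂, hb₂⟩ := hq _ _ _ d2 d2' (by fun_prop) (by ring) (by ring)
  refine ⟨K₂ / ℓ ^ 2 + (K₁ + 2 * ℓ * (K₂ / ℓ ^ 2)) / ℓ ^ 2, by positivity,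
    fun u w f f' h => ?_⟩
  have e1 := hb₁ u w f f' h
  have e2 := hb₂ u w f f' h
  set N := ‖u‖ + ‖w‖
  have hN : 0 ≤ N := by positivity
  have h0 : ‖f 0‖ ≤ K₂ / ℓ ^ 2 * N := by
    rw [div_mul_eq_mul_div, le_div_iff₀ (by positivity)]
    convert! e2 using 1
    rw [show (((0 : ℝ) * (ℓ - 0) ^ 2 : ℝ) : ℂ) * f' 0 -
      (((ℓ - 0) ^ 2 + 0 * (-2 * (ℓ - 0)) : ℝ) : ℂ) * f 0 = -(((ℓ ^ 2 : ℝ) : ℂ) * f 0) by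
        push_cast; ring, norm_neg, norm_mul, Complex.norm_real, Real.norm_of_nonneg (by positivity),
      mul_comm]
  have h1 : ‖f' 0‖ ≤ (K₁ + 2 * ℓ * (K₂ / ℓ ^ 2)) / ℓ ^ 2 * N := by
    rw [div_mul_eq_mul_div, le_div_iff₀ (by positivity)]
    have e3 : ((ℓ ^ 2 : ℝ) : ℂ) * f' 0 = ((((ℓ - 0) ^ 2 : ℝ) : ℂ) * f' 0 -
      ((-2 * (ℓ - 0) : ℝ) : ℂ) * f 0) - ((2 * ℓ : ℝ) : ℂ) * f 0 := by push_cast; ring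
    have e4 : ‖((ℓ ^ 2 : ℝ) : ℂ) * f' 0‖ ≤ K₁ * N + 2 * ℓ * (K₂ / ℓ ^ 2 * N) := by
      rw [e3]
      refine (norm_sub_le _ _).trans (add_le_add e1 ?_)
      rw [norm_mul, Complex.norm_real, Real.norm_of_nonneg (by positivity)]
      gcongr
    rw [norm_mul, Complex.norm_real, Real.norm_of_nonneg (by positivity)] at e4
    linarith
  constructor
  · refine h0.trans ?_
    gcongr
    exact le_add_of_nonneg_right (by positivity)
  · refine h1.trans ?_
    gcongr
    exact le_add_of_nonneg_left (by positivity)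

namespace IsFundamentalSystem

variable {E : ℝ} {C S : ℝ → ℝ}

theorem continuous_C (h : IsFundamentalSystem E C S) : Continuous C :=
  continuous_iff_continuousAt.2 fun x => (h.hasDerivAt_C x).continuousAt

theorem continuous_S (h : IsFundamentalSystem E C S) : Continuous S :=
  continuous_iff_continuousAt.2 fun x => (h.hasDerivAt_S x).continuousAt

theorem isW21On_C (h : IsFundamentalSystem E C S) (ℓ : ℝ) :
    IsW21On ℓ (fun x => -(E * C x : ℂ)) (fun x => (C x : ℂ)) (fun x => -(E * S x : ℂ)) := by
  have hc := h.continuous_C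
  refine IsW21On.of_hasDerivAt (fun x => ?_) (fun x => ?_) (by fun_prop) ℓ
  · convert! (h.hasDerivAt_C x).ofReal_comp using 1; push_cast; ring
  · exact ((h.hasDerivAt_S x).ofReal_comp.const_mul _).neg

theorem isW21On_S (h : IsFundamentalSystem E C S) (ℓ : ℝ) :
    IsW21On ℓ (fun x => -(E * S x : ℂ)) (fun x => (S x : ℂ)) (fun x => (C x : ℂ)) := by
  have hc := h.continuous_S
  refine IsW21On.of_hasDerivAt (fun x => ?_) (fun x => ?_) (by fun_prop) ℓ
  · exact (h.hasDerivAt_S x).ofReal_comp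
  · convert! (h.hasDerivAt_C x).ofReal_comp using 1; push_cast; ring

theorem sq_add_sq_complex (h : IsFundamentalSystem E C S) (x : ℝ) :
    (C x : ℂ) ^ 2 + E * (S x : ℂ) ^ 2 = 1 := by exact_mod_cast h.sq_add_sq x

/-- Variation of constants: every solution of `-f'' = E f + y` is determined by its initial
data. -/
theorem solution_eq (h : IsFundamentalSystem E C S) {ℓ : ℝ} {u y : EdgeL2 ℓ} {f f' : ℝ → ℂ}
    (hf : IsW22Rep ℓ u (-(y + (E : ℂ) • u)) f f') {x : ℝ} (hx : x ∈ Icc 0 ℓ) :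
    f x = C x * (f 0 + ∫ t in (0 : ℝ)..x, (S t : ℂ) * y t) +
        S x * (f' 0 - ∫ t in (0 : ℝ)..x, (C t : ℂ) * y t) ∧
      f' x = C x * (f' 0 - ∫ t in (0 : ℝ)..x, (C t : ℂ) * y t) -
        E * S x * (f 0 + ∫ t in (0 : ℝ)..x, (S t : ℂ) * y t) := by
  have hf1 := (hf.isW21On (hx.1.trans hx.2)).mono hx
  have hw : ∀ᵐ t ∂volume.restrict (Ioc 0 x),
      (-(y + (E : ℂ) • u) : EdgeL2 ℓ) t = -(y t + E * f t) := by
    refine ae_mono (Measure.restrict_mono (Ioc_subset_Ioc_right hx.2) le_rfl) ?_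
    filter_upwards [Lp.coeFn_neg (y + (E : ℂ) • u), Lp.coeFn_add y ((E : ℂ) • u),
      Lp.coeFn_smul (E : ℂ) u, hf.ae_eq] with t h1 h2 h3 h4
    rw [h1, Pi.neg_apply, h2, Pi.add_apply, h3, Pi.smul_apply, h4, smul_eq_mul]
  -- Green's identity against a homogeneous solution cancels the `E` terms and leaves only `y`.
  -- Taking `C` and `S` gives a linear system for `f x` and `f' x`, inverted by means of `C² + E S²
  -- = 1`.
  have key : ∀ c c' : ℝ → ℂ, IsW21On x (fun t => -(E * c t)) c c' →
      -∫ t in (0 : ℝ)..x, c t * y t = (c x * f' x - c' x * f x) - (c 0 * f' 0 - c' 0 * f 0) := by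
    intro c c' hc
    rw [← hc.green hf1 hx.1, ← intervalIntegral.integral_neg, intervalIntegral.integral_of_le hx.1,
      intervalIntegral.integral_of_le hx.1]
    refine integral_congr_ae ?_
    filter_upwards [hw] with t ht
    rw [ht]; ring
  have e1 := key _ _ (h.isW21On_C x)
  have e2 := key _ _ (h.isW21On_S x)
  have e3 := h.sq_add_sq_complex x
  rw [h.C_zero, h.S_zero] at e1 e2
  push_cast at e1 e2
  constructor
  · linear_combination (-f x) * e3 + (-S x : ℂ) * e1 + (C x : ℂ) * e2
  · linear_combination (-f' x) * e3 - (C x : ℂ) * e1 - (E * S x : ℂ) * e2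

/-- Existence of solutions of `-f'' = E f + y` with prescribed initial data, with a bound. -/
theorem exists_solution (h : IsFundamentalSystem E C S) (ℓ : ℝ) :
    ∃ K : ℝ, 0 ≤ K ∧ ∀ (y : EdgeL2 ℓ) (α β : ℂ), ∃ (u : EdgeL2 ℓ) (f f' : ℝ → ℂ),
      IsW22Rep ℓ u (-(y + (E : ℂ) • u)) f f' ∧ f 0 = α ∧ f' 0 = β ∧
      ‖u‖ ≤ K * (‖y‖ + ‖α‖ + ‖β‖) := by
  have cC : Continuous fun x => (C x : ℂ) := Complex.continuous_ofReal.comp h.continuous_C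
  have cS : Continuous fun x => (S x : ℂ) := Complex.continuous_ofReal.comp h.continuous_S
  obtain ⟨K₁, hK₁, hb₁⟩ := exists_norm_integral_mul_le ℓ cS
  obtain ⟨K₂, hK₂, hb₂⟩ := exists_norm_integral_mul_le ℓ cC
  obtain ⟨B₁, hB₁⟩ := isCompact_Icc.exists_bound_of_continuousOn (s := Icc 0 ℓ) cC.continuousOn
  obtain ⟨B₂, hB₂⟩ := isCompact_Icc.exists_bound_of_continuousOn (s := Icc 0 ℓ) cS.continuousOn
  set μ := volume.restrict (Ioc (0 : ℝ) ℓ) with hμ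
  set V : ℝ := (measureUnivNNReal μ : ℝ) ^ (2 : ENNReal).toReal⁻¹ with hV
  have hV0 : 0 ≤ V := by positivity
  refine ⟨V * (|B₁| * (1 + K₁) + |B₂| * (1 + K₂)), by positivity, fun y α β => ?_⟩
  set y₀ : ℝ → ℂ := (Ioc (0 : ℝ) ℓ).indicator y with hy₀
  have hy₀i : Integrable y₀ := by
    rw [hy₀, integrable_indicator_iff measurableSet_Ioc]
    exact (Lp.memLp y).integrable (by norm_num)
  have hY1c : Continuous fun x : ℝ => ∫ t in (0 : ℝ)..x, y₀ t :=
    intervalIntegral.continuous_primitive (fun a b => hy₀i.intervalIntegrable) 0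
  -- Since `y` is only square integrable, its second primitive `Y2` is split off: `f = q - Y2`,
  -- where `q'' = -E q + E Y2` has a continuous source and is solved classically by variation of
  -- constants.
  set Y1 : ℝ → ℂ := fun x => ∫ t in (0 : ℝ)..x, y₀ t with hY1
  set Y2 : ℝ → ℂ := fun x => ∫ t in (0 : ℝ)..x, Y1 t with hY2
  have dprim : ∀ g : ℝ → ℂ, Continuous g → ∀ x, HasDerivAt (fun x => ∫ t in (0 : ℝ)..x, g t)
      (g x) x := fun g hg x =>
    intervalIntegral.integral_hasDerivAt_right (hg.intervalIntegrable _ _)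
      (hg.stronglyMeasurableAtFilter _ _) hg.continuousAt
  have dY2 : ∀ x, HasDerivAt Y2 (Y1 x) x := dprim Y1 hY1c
  have hY2c : Continuous Y2 := continuous_iff_continuousAt.2 fun x => (dY2 x).continuousAt
  set A : ℝ → ℂ := fun x => β + ∫ t in (0 : ℝ)..x, (C t : ℂ) * (E * Y2 t) with hA
  set B : ℝ → ℂ := fun x => α - ∫ t in (0 : ℝ)..x, (S t : ℂ) * (E * Y2 t) with hB
  have dA : ∀ x, HasDerivAt A (C x * (E * Y2 x)) x := fun x =>
    (dprim _ (cC.mul (continuous_const.mul hY2c)) x).const_add β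
  have dB : ∀ x, HasDerivAt B (-(S x * (E * Y2 x))) x := fun x =>
    (dprim _ (cS.mul (continuous_const.mul hY2c)) x).const_sub α
  have dC : ∀ x, HasDerivAt (fun x => (C x : ℂ)) (-(E * S x : ℂ)) x := fun x => by
    convert! (h.hasDerivAt_C x).ofReal_comp using 1; push_cast; ring
  have dS : ∀ x, HasDerivAt (fun x => (S x : ℂ)) (C x : ℂ) x := fun x =>
    (h.hasDerivAt_S x).ofReal_comp
  set q : ℝ → ℂ := fun x => S x * A x + C x * B x with hq
  set q' : ℝ → ℂ := fun x => C x * A x - E * S x * B x with hq'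
  have dq : ∀ x, HasDerivAt q (q' x) x := fun x => by
    convert! ((dS x).mul (dA x)).add ((dC x).mul (dB x)) using 1
    simp only [hq']; ring
  have dq' : ∀ x, HasDerivAt q' (E * Y2 x - E * q x) x := fun x => by
    convert! ((dC x).mul (dA x)).sub (((dS x).const_mul (E : ℂ)).mul (dB x)) using 1
    simp only [hq]
    linear_combination (-(E * Y2 x)) * h.sq_add_sq_complex x
  have cq : Continuous q := continuous_iff_continuousAt.2 fun x => (dq x).continuousAt
  have W := IsW21On.of_hasDerivAt dq dq' (by fun_prop) ℓ
  set f : ℝ → ℂ := fun x => q x - Y2 x with hf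
  set f' : ℝ → ℂ := fun x => q' x - Y1 x with hf'
  have df : ∀ x, HasDerivAt f (f' x) x := fun x => (dq x).sub (dY2 x)
  have cf : Continuous f := continuous_iff_continuousAt.2 fun x => (df x).continuousAt
  have f0 : f 0 = α := by simp [hf, hq, hA, hB, hY2, h.C_zero, h.S_zero]
  have f0' : f' 0 = β := by simp [hf', hq', hA, hB, hY1, h.C_zero, h.S_zero]
  have hmem : MemLp f 2 μ := by
    obtain ⟨M, hM⟩ := isCompact_Icc.exists_bound_of_continuousOn (s := Icc 0 ℓ) cf.continuousOn
    refine MemLp.of_bound cf.aestronglyMeasurable M ?_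
    exact (ae_restrict_iff' measurableSet_Ioc).2
      (Filter.Eventually.of_forall fun t ht => hM t ⟨ht.1.le, ht.2⟩)
  have hrep : IsW22Rep ℓ (hmem.toLp f) (-(y + (E : ℂ) • hmem.toLp f)) f f' := by
    refine ⟨hmem.coeFn_toLp, fun x _ => (df x).hasDerivWithinAt, fun x hx => ?_⟩
    have hw : (-(y + (E : ℂ) • hmem.toLp f) : EdgeL2 ℓ) =ᵐ[μ]
        fun t => (E * Y2 t - E * q t) - y₀ t := by
      filter_upwards [Lp.coeFn_neg (y + (E : ℂ) • hmem.toLp f),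
        Lp.coeFn_add y ((E : ℂ) • hmem.toLp f), Lp.coeFn_smul (E : ℂ) (hmem.toLp f),
        hmem.coeFn_toLp, ae_restrict_mem measurableSet_Ioc] with t h1 h2 h3 h4 h5
      rw [h1, Pi.neg_apply, h2, Pi.add_apply, h3, Pi.smul_apply, h4, smul_eq_mul, hy₀,
        indicator_of_mem h5]
      simp only [hf]
      ring
    rw [EdgeL2.integral_congr hw hx, intervalIntegral.integral_sub (W.mono hx).integrable
      hy₀i.intervalIntegrable]
    have := W.deriv_eq x hx
    simp only [hf', this, hY1, intervalIntegral.integral_same]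
    ring
  refine ⟨hmem.toLp f, f, f', hrep, f0, f0', ?_⟩
  -- The formula in terms of `y` and the initial data gives the bound directly, without estimating
  -- `q` and `Y2`.
  have hbound : ∀ x ∈ Icc 0 ℓ, ‖f x‖ ≤
      (|B₁| * (1 + K₁) + |B₂| * (1 + K₂)) * (‖y‖ + ‖α‖ + ‖β‖) := fun x hx => by
    rw [(h.solution_eq hrep hx).1, f0, f0']
    set N := ‖y‖ + ‖α‖ + ‖β‖
    have n1 : ‖α + ∫ t in (0 : ℝ)..x, (S t : ℂ) * y t‖ ≤ (1 + K₁) * N := by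
      refine (norm_add_le _ _).trans ((add_le_add le_rfl (hb₁ y x hx)).trans ?_)
      have := mul_nonneg hK₁ (norm_nonneg α)
      have := mul_nonneg hK₁ (norm_nonneg β)
      simp only [N]
      linarith [norm_nonneg y, norm_nonneg β]
    have n2 : ‖β - ∫ t in (0 : ℝ)..x, (C t : ℂ) * y t‖ ≤ (1 + K₂) * N := by
      refine (norm_sub_le _ _).trans ((add_le_add le_rfl (hb₂ y x hx)).trans ?_)
      have := mul_nonneg hK₂ (norm_nonneg α)
      have := mul_nonneg hK₂ (norm_nonneg β)
      simp only [N]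
      linarith [norm_nonneg y, norm_nonneg α]
    refine (norm_add_le _ _).trans ?_
    rw [norm_mul, norm_mul, add_mul, mul_assoc, mul_assoc]
    gcongr
    · exact (hB₁ x hx).trans (le_abs_self _)
    · exact (hB₂ x hx).trans (le_abs_self _)
  rw [mul_assoc]
  refine Lp.norm_le_of_ae_bound (by positivity) ?_
  filter_upwards [hmem.coeFn_toLp, ae_restrict_mem measurableSet_Ioc] with t h1 h2
  rw [h1]
  exact hbound t ⟨h2.1.le, h2.2⟩

end IsFundamentalSystem

/-! ## Isolated simple eigenvalues of symmetric operators -/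

section Abstract

open scoped InnerProductSpace

variable {H : Type*} [NormedAddCommGroup H] [InnerProductSpace ℂ H]

theorem mem_opEigenspace {A : H →ₗ.[ℂ] H} {z : ℂ} {x : H} :
    x ∈ opEigenspace A z ↔ ∃ h : x ∈ A.domain, A ⟨x, h⟩ = z • x := by
  simp only [opEigenspace, Submodule.mem_map, LinearMap.mem_ker, LinearMap.sub_apply,
    LinearMap.smul_apply, Submodule.subtype_apply, sub_eq_zero]
  constructor
  · rintro ⟨y, hy, rfl⟩
    exact ⟨y.2, hy⟩
  · rintro ⟨h, hx⟩
    exact ⟨⟨x, h⟩, hx, rfl⟩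

/-- If `A` is symmetric, `φ` is an eigenvector for the real eigenvalue `E`, and the range of `A - E`
contains the orthogonal complement of `φ`, then `E` belongs to the discrete spectrum. -/
theorem mem_opDiscreteSpectrum_of_symmetric [CompleteSpace H] (A : H →ₗ.[ℂ] H)
    (hA : ∀ x y : A.domain, ⟪A x, (y : H)⟫_ℂ = ⟪(x : H), A y⟫_ℂ) (E : ℝ) (φ₀ : A.domain)
    (hφ₀ : φ₀ ≠ 0) (hAφ₀ : A φ₀ = (E : ℂ) • (φ₀ : H))
    (hsol : ∀ y : H, ⟪(φ₀ : H), y⟫_ℂ = 0 → ∃ u : A.domain, A u - (E : ℂ) • (u : H) = y) :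
    (E : ℂ) ∈ opDiscreteSpectrum A := by
  have hφ₀' : (φ₀ : H) ≠ 0 := fun h => hφ₀ (Subtype.ext h)
  obtain ⟨φ, hφ, hAφ, hsol⟩ : ∃ φ : A.domain, ‖(φ : H)‖ = 1 ∧ A φ = (E : ℂ) • (φ : H) ∧
      ∀ y : H, ⟪(φ : H), y⟫_ℂ = 0 → ∃ u : A.domain, A u - (E : ℂ) • (u : H) = y := by
    have hc : ((‖(φ₀ : H)‖⁻¹ : ℝ) : ℂ) ≠ 0 := by simpa using hφ₀'
    refine ⟨((‖(φ₀ : H)‖⁻¹ : ℝ) : ℂ) • φ₀, ?_, ?_, fun y hy => hsol y ?_⟩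
    · simp [norm_smul, hφ₀']
    · rw [LinearPMap.map_smul, hAφ₀, Submodule.coe_smul, smul_comm]
    · rw [Submodule.coe_smul, inner_smul_left] at hy
      exact (mul_eq_zero.1 hy).resolve_left (by simpa using hφ₀')
  have hφφ : ⟪(φ : H), (φ : H)⟫_ℂ = 1 := by
    rw [inner_self_eq_norm_sq_to_K, hφ]; simp
  have hEinner : ∀ x : A.domain, ⟪(φ : H), A x⟫_ℂ = E * ⟪(φ : H), (x : H)⟫_ℂ := fun x => by
    rw [← hA, hAφ, inner_smul_left, Complex.conj_ofReal]
  -- Adding the projection onto `φ` to `A - E` fills the missing direction of the range. Being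
  -- symmetric and surjective, `T` is also injective.
  set T : A.domain →ₗ[ℂ] H := A.toFun - (E : ℂ) • A.domain.subtype +
    ((innerSL ℂ (φ : H) : H →ₗ[ℂ] ℂ).smulRight (φ : H)).comp A.domain.subtype with hT
  have hTapp : ∀ x : A.domain, T x = A x - (E : ℂ) • (x : H) + ⟪(φ : H), (x : H)⟫_ℂ • (φ : H) :=
    fun x => rfl
  have hTsym : ∀ x y : A.domain, ⟪T x, (y : H)⟫_ℂ = ⟪(x : H), T y⟫_ℂ := fun x y => by
    simp only [hTapp, inner_add_left, inner_sub_left, inner_smul_left, inner_add_right,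
      inner_sub_right, inner_smul_right, hA, inner_conj_symm, Complex.conj_ofReal]
    ring
  have hTsurj : Function.Surjective T := fun y => by
    obtain ⟨u, hu⟩ := hsol (y - ⟪(φ : H), y⟫_ℂ • (φ : H)) (by
      rw [inner_sub_right, inner_smul_right, hφφ, mul_one, sub_self])
    refine ⟨u + (⟪(φ : H), y⟫_ℂ - ⟪(φ : H), (u : H)⟫_ℂ) • φ, ?_⟩
    rw [map_add, map_smul, hTapp u, hu, hTapp φ, hAφ, hφφ]
    module
  have hTinj : Function.Injective T := by
    rw [← LinearMap.ker_eq_bot, LinearMap.ker_eq_bot']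
    intro x hx
    obtain ⟨y, hy⟩ := hTsurj (x : H)
    have := hTsym x y
    rw [hx, inner_zero_left, hy, eq_comm, inner_self_eq_zero] at this
    exact Subtype.ext this
  set e := LinearEquiv.ofBijective T ⟨hTinj, hTsurj⟩ with he
  have hTe : ∀ y, T (e.symm y) = y := fun y => e.apply_symm_apply y
  have heT : ∀ x, e.symm (T x) = x := fun x => e.symm_apply_apply x
  set R₀ : H →ₗ[ℂ] H := A.domain.subtype.comp e.symm.toLinearMap with hR₀
  have hR₀sym : R₀.IsSymmetric := fun y z => by
    change ⟪((e.symm y : A.domain) : H), z⟫_ℂ = ⟪y, ((e.symm z : A.domain) : H)⟫_ℂ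
    conv_lhs => rw [← hTe z]
    conv_rhs => rw [← hTe y]
    exact (hTsym _ _).symm
  -- Hellinger–Toeplitz: an everywhere defined symmetric operator is bounded. No closedness of `A`
  -- has to be shown.
  set R : H →L[ℂ] H := ⟨R₀, hR₀sym.continuous⟩ with hR
  have hRapp : ∀ y, R y = (e.symm y : A.domain) := fun y => rfl
  have hker : ∀ x : A.domain, A x = (E : ℂ) • (x : H) → (x : H) = ⟪(φ : H), (x : H)⟫_ℂ • (φ : H) := by
    intro x hx
    have h1 : T (x - ⟪(φ : H), (x : H)⟫_ℂ • φ) = 0 := by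
      rw [map_sub, map_smul, hTapp x, hTapp φ, hAφ, hφφ, hx]
      module
    have h2 := hTinj (h1.trans (map_zero T).symm)
    have h3 := congrArg (Subtype.val) h2
    simpa [sub_eq_zero] using h3
  -- Within this radius `1 - (w - E) R` is inverted by a Neumann series; the `+ 1` covers `R = 0`.
  refine ⟨?_, ?_, (‖R‖ + 1)⁻¹, by positivity, fun w hw hwd => ?_⟩
  · intro hbot
    have : (φ : H) ∈ opEigenspace A E := mem_opEigenspace.2 ⟨φ.2, hAφ⟩
    rw [hbot, Submodule.mem_bot] at this
    rw [this, norm_zero] at hφ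
    exact zero_ne_one hφ
  · refine Submodule.finiteDimensional_of_le (S₂ := ℂ ∙ (φ : H)) fun x hx => ?_
    obtain ⟨h, hx⟩ := mem_opEigenspace.1 hx
    rw [Submodule.mem_span_singleton]
    exact ⟨_, (hker ⟨x, h⟩ hx).symm⟩
  · by_contra hne
    refine hw ?_
    have hEw : (E : ℂ) - w ≠ 0 := sub_ne_zero.2 (Ne.symm hne)
    set δ : ℂ := w - E with hδ
    have hnorm : ‖δ • R‖ < 1 := by
      rw [norm_smul]
      rw [dist_eq_norm] at hwd
      have h1 : ‖δ‖ * (‖R‖ + 1) < 1 := by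
        rwa [← lt_div_iff₀ (by positivity), one_div]
      nlinarith [norm_nonneg δ, norm_nonneg R]
    set Q := Units.oneSub (δ • R) hnorm with hQ
    have hQ1 : ∀ y, Q.inv y - δ • R (Q.inv y) = y := fun y => by
      have := congrArg (fun L : H →L[ℂ] H => L y) Q.val_inv
      simpa [hQ] using this
    have hQ2 : ∀ y, y - δ • R y = 0 → y = 0 := fun y hy => by
      have h1 : Q.inv (Q.val y) = y := congrArg (fun L : H →L[ℂ] H => L y) Q.inv_val
      have h2 : Q.val y = 0 := by simpa [hQ] using hy
      rw [← h1, h2, map_zero]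
    set G : H →L[ℂ] H := R.comp Q.inv with hG
    have hGapp : ∀ y, G y = (e.symm (Q.inv y) : A.domain) := fun y => rfl
    -- `G` inverts `T - (w - E)`, which is `A - w` plus the projection. As `(A - w) φ = (E - w) φ`,
    -- a rank-one correction along `φ` turns it into a right inverse of `A - w`.
    set L : H →L[ℂ] H := G + ((E : ℂ) - w)⁻¹ • ((innerSL ℂ (φ : H)).comp G).smulRight (φ : H)
      with hL
    have hinj : ∀ x : A.domain, A x - w • (x : H) = 0 → x = 0 := fun x hx => by
      rw [sub_eq_zero] at hx
      have h1 := hEinner x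
      rw [hx, inner_smul_right] at h1
      have h2 : ⟪(φ : H), (x : H)⟫_ℂ = 0 := by
        have : ((E : ℂ) - w) * ⟪(φ : H), (x : H)⟫_ℂ = 0 := by linear_combination -h1
        exact (mul_eq_zero.1 this).resolve_left hEw
      have h3 : T x = δ • (x : H) := by
        rw [hTapp, hx, h2, hδ]; module
      have h4 : (x : H) = δ • R x := by
        rw [← map_smul, ← h3, hRapp, heT]
      exact Subtype.ext (hQ2 x (sub_eq_zero.2 h4))
    have hLmem : ∀ y, L y = ((e.symm (Q.inv y) +
        (((E : ℂ) - w)⁻¹ * ⟪(φ : H), G y⟫_ℂ) • φ : A.domain) : H) := fun y => by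
      simp [hL, hGapp, smul_smul]
    have hright : ∀ y : H, ∃ h : L y ∈ A.domain, A ⟨L y, h⟩ - w • L y = y := fun y => by
      refine ⟨hLmem y ▸ Subtype.prop _, ?_⟩
      have h1 : (⟨L y, hLmem y ▸ Subtype.prop _⟩ : A.domain) = e.symm (Q.inv y) +
        (((E : ℂ) - w)⁻¹ * ⟪(φ : H), G y⟫_ℂ) • φ := Subtype.ext (hLmem y)
      rw [h1, hLmem y, LinearPMap.map_add, LinearPMap.map_smul, hAφ]
      have h2 := hTe (Q.inv y)
      rw [hTapp, ← hGapp] at h2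
      have h3 := hQ1 y
      rw [hRapp, ← hGapp] at h3
      rw [Submodule.coe_add, Submodule.coe_smul, ← hGapp]
      have h4 : A (e.symm (Q.inv y)) = y + w • G y - ⟪(φ : H), G y⟫_ℂ • (φ : H) := by
        have h5 : A (e.symm (Q.inv y)) =
            Q.inv y + (E : ℂ) • G y - ⟪(φ : H), G y⟫_ℂ • (φ : H) := by
          have aux : ∀ a b c d : H, a - b + c = d → a = d + b - c := by
            rintro a b c d rfl; abel
          exact aux _ _ _ _ h2
        rw [h5, eq_add_of_sub_eq h3, hδ]
        module
      rw [h4]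
      have h5 : ((E : ℂ) - w)⁻¹ * ((E : ℂ) - w) = 1 := inv_mul_cancel₀ hEw
      trans y + (⟪(φ : H), G y⟫_ℂ * (((E : ℂ) - w)⁻¹ * ((E : ℂ) - w)) -
        ⟪(φ : H), G y⟫_ℂ) • (φ : H)
      · module
      · rw [h5, mul_one, sub_self, zero_smul, add_zero]
    refine ⟨L, hright, fun x => ?_⟩
    -- A right inverse of an injective operator is also a left inverse.
    obtain ⟨h, hLx⟩ := hright (A x - w • (x : H))
    have h1 := hinj (⟨_, h⟩ - x) (by
      rw [LinearPMap.map_sub, Submodule.coe_sub, smul_sub, sub_sub_sub_comm, hLx, sub_self])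
    exact congrArg Subtype.val (sub_eq_zero.1 h1)

end Abstract

/-! ## Square summable families -/

section SquareSummable

variable {ι κ : Type*}

theorem memℓp_two_iff {G : ι → Type*} [∀ i, NormedAddCommGroup (G i)] {f : ∀ i, G i} : Memℓp f 2 ↔ Summable fun i => ‖f i‖ ^ 2 := by
  rw [memℓp_gen_iff (by norm_num)]
  norm_num

theorem Memℓp.comp_injective_two {g : ι → ℂ} (hg : Memℓp g 2) {i : κ → ι}
    (hi : Function.Injective i) : Memℓp (fun k => g (i k)) 2 := by
  rw [memℓp_two_iff] at hg ⊢
  exact hg.comp_injective hi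

theorem Memℓp.summable_mul_two {f g : ι → ℂ} (hf : Memℓp f 2) (hg : Memℓp g 2) :
    Summable fun i => f i * g i := by
  rw [memℓp_two_iff] at hf hg
  refine Summable.of_norm_bounded (hf.add hg) fun i => ?_
  rw [norm_mul]
  nlinarith [sq_nonneg (‖f i‖ - ‖g i‖), sq_nonneg (‖f i‖ + ‖g i‖)]

theorem Memℓp.star_two {f : ι → ℂ} (hf : Memℓp f 2) : Memℓp (fun i => star (f i)) 2 := by
  rw [memℓp_two_iff] at hf ⊢
  simpa using hf

theorem Memℓp.tendsto_zero_two {f : ι → ℂ} (hf : Memℓp f 2) :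
    Filter.Tendsto f Filter.cofinite (nhds 0) := by
  have h := (memℓp_two_iff.1 hf).tendsto_cofinite_zero
  rw [tendsto_zero_iff_norm_tendsto_zero]
  have := h.sqrt
  simpa using this

end SquareSummable

/-! ## Functions on the comb -/

theorem CombEdge.length_pos {a b : ℝ} (ha : 0 < a) (hb : 0 < b) (e : CombEdge) :
    0 < e.length a b := by
  cases e <;> simp [CombEdge.length, ha, hb]

/-- The edges of the comb, grouped by the vertices. -/
def combEdgeEquiv : ℤ × Fin 3 ≃ CombEdge where
  toFun p := match p with
    | (j, 0) => .rung j
    | (j, 1) => .up j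
    | (j, 2) => .down j
  invFun e := match e with
    | .rung j => (j, 0)
    | .up j => (j, 1)
    | .down j => (j, 2)
  left_inv := by rintro ⟨j, i⟩; fin_cases i <;> rfl
  right_inv := by rintro (j | j | j) <;> rfl

theorem CombEdge.rung_injective : Function.Injective CombEdge.rung := fun _ _ h => by
  injection h

theorem CombEdge.up_injective : Function.Injective CombEdge.up := fun _ _ h => by
  injection h

theorem CombEdge.down_injective : Function.Injective CombEdge.down := fun _ _ h => by
  injection h

theorem memℓp_combEdge {α : CombEdge → ℂ} (hr : Memℓp (fun j => α (.rung j)) 2)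
    (hu : Memℓp (fun j => α (.up j)) 2) (hd : Memℓp (fun j => α (.down j)) 2) : Memℓp α 2 := by
  rw [memℓp_two_iff] at hr hu hd ⊢
  rw [← combEdgeEquiv.summable_iff]
  have hnn : 0 ≤ (fun e => ‖α e‖ ^ 2) ∘ combEdgeEquiv := fun _ => sq_nonneg _
  rw [summable_prod_of_nonneg hnn]
  refine ⟨fun j => (hasSum_fintype _).summable, ?_⟩
  simp only [tsum_fintype, Fin.sum_univ_three]
  exact (hr.add hu).add hd

/-- `f` and `f'` are the edgewise `C¹` representatives of `u` and its derivative, and the second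
derivative of `u` is `w`. -/
def IsCombRep (a b : ℝ) (u w : CombL2 a b) (f f' : CombEdge → ℝ → ℂ) : Prop :=
  ∀ e, IsW22Rep (e.length a b) (u e) (w e) (f e) (f' e)

/-- Only the two lengths `a` and `b / 2` occur, so edgewise constants can be chosen uniformly over
the infinite comb. -/
theorem exists_common_bound {a b : ℝ} (P : ℝ → ℝ → Prop)
    (hmono : ∀ ℓ K L, P ℓ K → K ≤ L → P ℓ L) (ha : ∃ K, 0 ≤ K ∧ P a K)
    (hb : ∃ K, 0 ≤ K ∧ P (b / 2) K) : ∃ K, 0 ≤ K ∧ ∀ e : CombEdge, P (e.length a b) K := by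
  obtain ⟨K, hK, hPK⟩ := ha
  obtain ⟨L, hL, hPL⟩ := hb
  refine ⟨K + L, by positivity, fun e => ?_⟩
  cases e
  · exact hmono _ _ _ hPK (by linarith)
  · exact hmono _ _ _ hPL (by linarith)
  · exact hmono _ _ _ hPL (by linarith)

/-- The trace bound with a common constant dominates the traces by the square summable edge norms.
This provides both the decay of vertex values and the summability of boundary terms. -/
theorem IsCombRep.memℓp_trace {a b : ℝ} (ha : 0 < a) (hb : 0 < b) {u w : CombL2 a b}
    {f f' : CombEdge → ℝ → ℂ} (h : IsCombRep a b u w f f') :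
    Memℓp (fun e => f e 0) 2 ∧ Memℓp (fun e => f' e 0) 2 := by
  obtain ⟨K, hK, hKb⟩ := exists_common_bound (a := a) (b := b)
    (fun ℓ K => ∀ (u w : EdgeL2 ℓ) (f f' : ℝ → ℂ), IsW22Rep ℓ u w f f' →
      ‖f 0‖ ≤ K * (‖u‖ + ‖w‖) ∧ ‖f' 0‖ ≤ K * (‖u‖ + ‖w‖))
    (fun ℓ K L hP hKL u w f f' h => ⟨(hP u w f f' h).1.trans (by gcongr),
      (hP u w f f' h).2.trans (by gcongr)⟩)
    (exists_norm_trace_le ha) (exists_norm_trace_le (half_pos hb))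
  have hm : Memℓp (fun e => K * (‖u e‖ + ‖w e‖)) 2 :=
    ((memℓp_norm_iff.2 (lp.memℓp u)).add (memℓp_norm_iff.2 (lp.memℓp w))).const_mul K
  exact ⟨hm.mono fun e => (hKb e _ _ _ _ (h e)).1, hm.mono fun e => (hKb e _ _ _ _ (h e)).2⟩

open scoped InnerProductSpace in
/-- Green's identity on an edge. -/
theorem IsW22Rep.inner_sub_inner {ℓ : ℝ} (hℓ : 0 ≤ ℓ) {u w v z : EdgeL2 ℓ} {f f' g g' : ℝ → ℂ}
    (hf : IsW22Rep ℓ u w f f') (hg : IsW22Rep ℓ v z g g') :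
    ⟪v, w⟫_ℂ - ⟪z, u⟫_ℂ = (star (g ℓ) * f' ℓ - star (g' ℓ) * f ℓ) -
      (star (g 0) * f' 0 - star (g' 0) * f 0) := by
  rw [← (hg.isW21On hℓ).conj.green (hf.isW21On hℓ) hℓ, L2.inner_def, L2.inner_def,
    ← integral_sub (L2.integrable_inner v w) (L2.integrable_inner z u),
    intervalIntegral.integral_of_le hℓ]
  refine integral_congr_ae ?_
  filter_upwards [hf.ae_eq, hg.ae_eq] with t h1 h2
  simp only [RCLike.inner_apply, h1, h2, Complex.star_def]
  ring

open scoped InnerProductSpace in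
/-- Green's identity on the comb, for functions satisfying vertex conditions which differ only in
the coupling constant at `x_0`. -/
theorem IsCombRep.green {a b γ γ₁ γ₂ θ : ℝ} (ha : 0 < a) (hb : 0 < b) {u w v z : CombL2 a b}
    {f f' g g' : CombEdge → ℝ → ℂ} (hf : IsCombRep a b u w f f') (hg : IsCombRep a b v z g g')
    (hvf : CombVertexConditions a b γ γ₁ θ f f') (hvg : CombVertexConditions a b γ γ₂ θ g g') :
    ⟪v, w⟫_ℂ - ⟪z, u⟫_ℂ = ((γ₂ - γ₁ : ℝ) : ℂ) * (star (g (.up 0) 0) * f (.up 0) 0) := by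
  set W : CombEdge → ℝ → ℂ := fun e x => star (g e x) * f' e x - star (g' e x) * f e x with hW
  have hsum : HasSum (fun e : CombEdge => W e (e.length a b) - W e 0) (⟪v, w⟫_ℂ - ⟪z, u⟫_ℂ) := by
    have := (lp.hasSum_inner (𝕜 := ℂ) v w).sub (lp.hasSum_inner (𝕜 := ℂ) z u)
    refine this.congr_fun fun e => ?_
    exact ((hf e).inner_sub_inner (e.length_pos ha hb).le (hg e)).symm
  have hsum' := (combEdgeEquiv.hasSum_iff.2 hsum).prod_fiberwise (fun j => hasSum_fintype _)
  have hf0 := hf.memℓp_trace ha hb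
  have hg0 := hg.memℓp_trace ha hb
  have hT : Summable fun j : ℤ => W (.rung j) 0 := by
    have hi := CombEdge.rung_injective
    exact ((hg0.1.comp_injective_two hi).star_two.summable_mul_two
      (hf0.2.comp_injective_two hi)).sub ((hg0.2.comp_injective_two hi).star_two.summable_mul_two
      (hf0.1.comp_injective_two hi))
  -- Summability makes the telescoping sum along the chain vanish: there is no contribution from
  -- infinity.
  have hT' : HasSum (fun j : ℤ => W (.rung (j + 1)) 0 - W (.rung j) 0) 0 := by
    have h1 := (Equiv.addRight (1 : ℤ)).hasSum_iff.2 hT.hasSum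
    have := h1.sub hT.hasSum
    rwa [sub_self] at this
  have hδ : HasSum (fun j : ℤ => if j = 0 then
      ((γ₂ - γ₁ : ℝ) : ℂ) * (star (g (.up 0) 0) * f (.up 0) 0) else 0) _ := hasSum_ite_eq 0 _
  have htot := hT'.add hδ
  rw [zero_add] at htot
  refine hsum'.unique (htot.congr_fun fun j => ?_)
  have hexp : star (Complex.exp (Complex.I * θ)) * Complex.exp (Complex.I * θ) = 1 := by
    rw [Complex.star_def, ← Complex.exp_conj, ← Complex.exp_add]
    simp
  -- The Floquet phase has modulus one, so the Wronskians at `x_j^+` and `x_j^-` agree.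
  have key1 : W (.up j) (b / 2) = W (.down j) 0 := by
    simp only [hW, hvf.floquet, hvf.floquet_deriv, hvg.floquet, hvg.floquet_deriv, star_mul']
    linear_combination (star (g (.down j) 0) * f' (.down j) 0 -
      star (g' (.down j) 0) * f (.down j) 0) * hexp
  -- Equal real couplings make the Wronskian flux through a vertex vanish; at `x_0` the difference
  -- of the couplings remains.
  have key2 : W (.rung j) a - W (.up j) 0 + W (.down j) (b / 2) - W (.rung (j + 1)) 0 =
      if j = 0 then ((γ₂ - γ₁ : ℝ) : ℂ) * (star (g (.up 0) 0) * f (.up 0) 0) else 0 := by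
    have h1 := hvf.delta j
    have h2 := congrArg star (hvg.delta j)
    simp only [star_add, star_sub, star_mul', Complex.star_def, Complex.conj_ofReal] at h2
    simp only [hW, hvf.cont_rung, hvf.cont_rung_succ, hvf.cont_down, hvg.cont_rung,
      hvg.cont_rung_succ, hvg.cont_down, Complex.star_def]
    by_cases hj : j = 0
    · subst hj
      simp only [if_true, zero_add] at h1 h2 ⊢
      push_cast
      linear_combination (-(starRingEnd ℂ) (g (.up 0) 0)) * h1 + f (.up 0) 0 * h2
    · simp only [if_neg hj] at h1 h2 ⊢
      linear_combination (-(starRingEnd ℂ) (g (.up j) 0)) * h1 + f (.up j) 0 * h2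
  simp only [Fin.sum_univ_three, Function.comp_apply]
  change W (.rung j) a - W (.rung j) 0 + (W (.up j) (b / 2) - W (.up j) 0) +
    (W (.down j) (b / 2) - W (.down j) 0) = _
  rw [← key2, key1]
  ring

namespace IsFundamentalSystem

variable {E : ℝ} {C S : ℝ → ℝ} {a b : ℝ}

/-- Existence of edgewise solutions on the comb with prescribed square summable initial data. -/
theorem exists_combRep (h : IsFundamentalSystem E C S) (y : CombL2 a b) {α β : CombEdge → ℂ}
    (hα : Memℓp α 2) (hβ : Memℓp β 2) : ∃ (u : CombL2 a b) (f f' : CombEdge → ℝ → ℂ),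
      IsCombRep a b u (-(y + (E : ℂ) • u)) f f' ∧ (∀ e, f e 0 = α e) ∧ (∀ e, f' e 0 = β e) := by
  obtain ⟨K, hK, hKb⟩ := exists_common_bound (a := a) (b := b)
    (fun ℓ K => ∀ (y : EdgeL2 ℓ) (α β : ℂ), ∃ (u : EdgeL2 ℓ) (f f' : ℝ → ℂ),
      IsW22Rep ℓ u (-(y + (E : ℂ) • u)) f f' ∧ f 0 = α ∧ f' 0 = β ∧
      ‖u‖ ≤ K * (‖y‖ + ‖α‖ + ‖β‖))
    (fun ℓ K L hP hKL y α β => by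
      obtain ⟨u, f, f', h1, h2, h3, h4⟩ := hP y α β
      exact ⟨u, f, f', h1, h2, h3, h4.trans (by gcongr)⟩)
    (h.exists_solution a) (h.exists_solution (b / 2))
  choose u f f' h1 h2 h3 h4 using fun e => hKb e (y e) (α e) (β e)
  have hm : Memℓp (fun e => K * (‖y e‖ + ‖α e‖ + ‖β e‖)) 2 :=
    (((memℓp_norm_iff.2 (lp.memℓp y)).add (memℓp_norm_iff.2 hα)).add
      (memℓp_norm_iff.2 hβ)).const_mul K
  exact ⟨⟨u, hm.mono h4⟩, f, f', h1, h2, h3⟩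

/-- The contribution of the inhomogeneity to the final value on an edge. -/
def endValue (C S : ℝ → ℝ) {ℓ : ℝ} (y : EdgeL2 ℓ) : ℂ :=
  C ℓ * (∫ t in (0 : ℝ)..ℓ, (S t : ℂ) * y t) - S ℓ * ∫ t in (0 : ℝ)..ℓ, (C t : ℂ) * y t

/-- The contribution of the inhomogeneity to the final derivative on an edge. -/
def endDeriv (E : ℝ) (C S : ℝ → ℝ) {ℓ : ℝ} (y : EdgeL2 ℓ) : ℂ :=
  -(C ℓ * ∫ t in (0 : ℝ)..ℓ, (C t : ℂ) * y t) - E * S ℓ * ∫ t in (0 : ℝ)..ℓ, (S t : ℂ) * y t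

theorem memℓp_endValue (h : IsFundamentalSystem E C S) (ha : 0 < a) (hb : 0 < b)
    (y : CombL2 a b) : Memℓp (fun e => endValue C S (y e)) 2 ∧
      Memℓp (fun e => endDeriv E C S (y e)) 2 := by
  have hedge : ∀ ℓ : ℝ, 0 < ℓ → ∃ K : ℝ, 0 ≤ K ∧ ∀ y : EdgeL2 ℓ, ‖endValue C S y‖ ≤ K * ‖y‖ ∧
      ‖endDeriv E C S y‖ ≤ K * ‖y‖ := by
    intro ℓ hℓ
    obtain ⟨K₁, hK₁, hb₁⟩ := exists_norm_integral_mul_le ℓ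
      (Complex.continuous_ofReal.comp h.continuous_S)
    obtain ⟨K₂, hK₂, hb₂⟩ := exists_norm_integral_mul_le ℓ
      (Complex.continuous_ofReal.comp h.continuous_C)
    refine ⟨(‖(C ℓ : ℂ)‖ * K₁ + ‖(S ℓ : ℂ)‖ * K₂) +
      (‖(C ℓ : ℂ)‖ * K₂ + ‖(E * S ℓ : ℂ)‖ * K₁), by positivity, fun y => ?_⟩
    have e1 := hb₁ y ℓ ⟨hℓ.le, le_rfl⟩
    have e2 := hb₂ y ℓ ⟨hℓ.le, le_rfl⟩
    simp only [Function.comp_apply] at e1 e2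
    constructor
    · calc _ ≤ ‖(C ℓ : ℂ)‖ * (K₁ * ‖y‖) + ‖(S ℓ : ℂ)‖ * (K₂ * ‖y‖) := by
            refine (norm_sub_le _ _).trans ?_
            rw [norm_mul, norm_mul]
            gcongr
        _ = (‖(C ℓ : ℂ)‖ * K₁ + ‖(S ℓ : ℂ)‖ * K₂) * ‖y‖ := by ring
        _ ≤ _ := by
            exact mul_le_mul_of_nonneg_right (le_add_of_nonneg_right (by positivity))
              (norm_nonneg _)
    · calc _ ≤ ‖(C ℓ : ℂ)‖ * (K₂ * ‖y‖) + ‖(E * S ℓ : ℂ)‖ * (K₁ * ‖y‖) := by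
            refine (norm_sub_le _ _).trans ?_
            rw [norm_neg, norm_mul, norm_mul]
            gcongr
        _ = (‖(C ℓ : ℂ)‖ * K₂ + ‖(E * S ℓ : ℂ)‖ * K₁) * ‖y‖ := by ring
        _ ≤ _ := by
            exact mul_le_mul_of_nonneg_right (le_add_of_nonneg_left (by positivity))
              (norm_nonneg _)
  obtain ⟨K, hK, hKb⟩ := exists_common_bound (a := a) (b := b)
    (fun ℓ K => ∀ y : EdgeL2 ℓ, ‖endValue C S y‖ ≤ K * ‖y‖ ∧ ‖endDeriv E C S y‖ ≤ K * ‖y‖)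
    (fun ℓ K L hP hKL y => ⟨(hP y).1.trans (by gcongr), (hP y).2.trans (by gcongr)⟩)
    (hedge a ha) (hedge (b / 2) (half_pos hb))
  have hm : Memℓp (fun e => K * ‖y e‖) 2 := (memℓp_norm_iff.2 (lp.memℓp y)).const_mul K
  exact ⟨hm.mono fun e => (hKb e _).1, hm.mono fun e => (hKb e _).2⟩

theorem endpoint_eq (h : IsFundamentalSystem E C S) (ha : 0 < a) (hb : 0 < b)
    {u y : CombL2 a b} {f f' : CombEdge → ℝ → ℂ}
    (hf : IsCombRep a b u (-(y + (E : ℂ) • u)) f f') (e : CombEdge) :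
    f e (e.length a b) = C (e.length a b) * f e 0 + S (e.length a b) * f' e 0 +
        endValue C S (y e) ∧
      f' e (e.length a b) = C (e.length a b) * f' e 0 - E * S (e.length a b) * f e 0 +
        endDeriv E C S (y e) := by
  obtain ⟨h1, h2⟩ := h.solution_eq (hf e) ⟨(e.length_pos ha hb).le, le_rfl⟩
  rw [h1, h2, endValue, endDeriv]
  constructor <;> ring

theorem endValue_zero {ℓ : ℝ} (hℓ : 0 < ℓ) :
    endValue C S (0 : EdgeL2 ℓ) = 0 ∧ endDeriv E C S (0 : EdgeL2 ℓ) = 0 := by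
  have h0 : ∀ q : ℝ → ℂ, ∫ t in (0 : ℝ)..ℓ, q t * (0 : EdgeL2 ℓ) t = 0 := fun q => by
    rw [intervalIntegral.integral_of_le hℓ.le]
    refine integral_eq_zero_of_ae ?_
    filter_upwards [Lp.coeFn_zero ℂ 2 (volume.restrict (Ioc (0 : ℝ) ℓ))] with t ht
    rw [ht]; simp
  constructor <;> simp only [endValue, endDeriv, h0, mul_zero, sub_zero, neg_zero]

end IsFundamentalSystem

/-! ## Difference equations on `ℤ` -/

/-- The shift on `ℓ²(ℤ)`. -/
def shiftL2 (k : ℤ) : lp (fun _ : ℤ => ℂ) 2 →ₗᵢ[ℂ] lp (fun _ : ℤ => ℂ) 2 where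
  toFun ψ := ⟨fun j => ψ (j + k), (lp.memℓp ψ).comp_injective_two (add_left_injective k)⟩
  map_add' _ _ := rfl
  map_smul' _ _ := rfl
  norm_map' ψ := by
    rw [lp.norm_eq_tsum_rpow (by norm_num), lp.norm_eq_tsum_rpow (by norm_num)]
    congr 1
    exact (Equiv.addRight k).tsum_eq fun j => ‖ψ j‖ ^ (2 : ENNReal).toReal

/-- The sum of the two shifts has norm at most `2`, so `2 M` lies in its resolvent set. -/
theorem exists_solution_of_one_lt_abs {M : ℝ} (hM : 1 < |M|) {F : ℤ → ℂ} (hF : Memℓp F 2) :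
    ∃ ψ : ℤ → ℂ, Memℓp ψ 2 ∧ ∀ j, ψ (j + 1) + ψ (j - 1) - 2 * M * ψ j = F j := by
  set T : lp (fun _ : ℤ => ℂ) 2 →L[ℂ] lp (fun _ : ℤ => ℂ) 2 :=
    (shiftL2 1).toContinuousLinearMap + (shiftL2 (-1)).toContinuousLinearMap with hT
  have hTn : ‖T‖ < ‖(2 * M : ℂ)‖ := by
    have h1 : ‖T‖ ≤ 1 + 1 := (norm_add_le _ _).trans
      (add_le_add (shiftL2 1).norm_toContinuousLinearMap_le
        (shiftL2 (-1)).norm_toContinuousLinearMap_le)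
    rw [norm_mul, Complex.norm_real, Real.norm_eq_abs]
    norm_num
    linarith
  have hres := spectrum.mem_resolventSet_of_norm_lt_mul (𝕜 := ℂ)
    ((mul_le_of_le_one_right (norm_nonneg T) ContinuousLinearMap.norm_id_le).trans_lt hTn)
  obtain ⟨U, hU⟩ := spectrum.mem_resolventSet_iff.1 hres
  set φ := U.inv ⟨-F, hF.neg⟩ with hφ
  have h1 : (algebraMap ℂ _ (2 * M : ℂ) - T) φ = ⟨-F, hF.neg⟩ := by
    rw [← hU]
    exact congrArg (fun L : lp (fun _ : ℤ => ℂ) 2 →L[ℂ] lp (fun _ : ℤ => ℂ) 2 =>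
      L ⟨-F, hF.neg⟩) U.val_inv
  refine ⟨φ, lp.memℓp φ, fun j => ?_⟩
  have h2 := congrArg (fun ψ : lp (fun _ : ℤ => ℂ) 2 => ψ j) h1
  have h3 : 2 * M * φ j - (φ (j + 1) + φ (j + -1)) = -F j := h2
  rw [← sub_eq_add_neg] at h3
  linear_combination -h3

/-- A sequence satisfying a one-sided three-term recurrence and decaying at infinity. -/
theorem eq_mul_of_recurrence {lam : ℂ} (hl0 : lam ≠ 0) (hl1 : ‖lam‖ ≤ 1) {ψ : ℕ → ℂ}
    (h : ∀ n, ψ (n + 2) + ψ n = (lam + lam⁻¹) * ψ (n + 1))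
    (h0 : Filter.Tendsto ψ Filter.atTop (nhds 0)) (n : ℕ) : ψ (n + 1) = lam * ψ n := by
  -- The component along the other root: it satisfies `lam * t (n + 1) = t n`, so its modulus never
  -- decreases, yet it tends to `0`. The case `‖lam‖ = 1` is covered as well.
  set t : ℕ → ℂ := fun n => ψ (n + 1) - lam * ψ n with ht
  have hstep : ∀ n, lam * t (n + 1) = t n := fun n => by
    have := h n
    have hl : lam * lam⁻¹ = 1 := mul_inv_cancel₀ hl0
    simp only [ht]
    linear_combination lam * this + ψ (n + 1) * hl
  have hmono : ∀ n m, ‖t n‖ ≤ ‖t (n + m)‖ := fun n m => by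
    induction m with
    | zero => simp
    | succ m ih =>
      refine ih.trans ?_
      rw [← hstep (n + m), norm_mul]
      exact mul_le_of_le_one_left (norm_nonneg _) hl1
  have hlim : Filter.Tendsto t Filter.atTop (nhds 0) := by
    have := ((Filter.tendsto_add_atTop_iff_nat 1).2 h0).sub (h0.const_mul lam)
    simpa using this
  have hlim' : Filter.Tendsto (fun m => ‖t (n + m)‖) Filter.atTop (nhds 0) := by
    have := (tendsto_zero_iff_norm_tendsto_zero.1 hlim).comp (Filter.tendsto_add_atTop_nat n)
    refine this.congr fun m => ?_
    simp [add_comm]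
  have := ge_of_tendsto' hlim' (hmono n)
  exact sub_eq_zero.1 (norm_le_zero_iff.1 this)

/-- The two roots `M ± s`, with `s² = M² - 1`, have product `1`, so one of them lies in the closed
unit disc. -/
theorem exists_root_norm_le_one (M : ℝ) :
    ∃ lam : ℂ, lam ≠ 0 ∧ ‖lam‖ ≤ 1 ∧ lam + lam⁻¹ = 2 * M := by
  obtain ⟨s, hs⟩ := IsAlgClosed.exists_pow_nat_eq ((M : ℂ) ^ 2 - 1) (n := 2) (by norm_num)
  have hprod : ((M : ℂ) + s) * (M - s) = 1 := by linear_combination -hs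
  have h1 : (M : ℂ) + s ≠ 0 := left_ne_zero_of_mul_eq_one hprod
  have h2 : (M : ℂ) - s ≠ 0 := right_ne_zero_of_mul_eq_one hprod
  have hi : ((M : ℂ) + s)⁻¹ = M - s := inv_eq_of_mul_eq_one_right hprod
  rcases le_total ‖(M : ℂ) + s‖ 1 with h | h
  · exact ⟨_, h1, h, by rw [hi]; ring⟩
  · refine ⟨M - s, h2, ?_, by rw [← hi, inv_inv, hi]; ring⟩
    have := congrArg norm hprod
    rw [norm_mul, norm_one] at this
    nlinarith [norm_nonneg ((M : ℂ) - s)]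

/-- Decaying solutions of the recurrence with a perturbation at `0`. -/
theorem eq_zero_or_of_recurrence {M G : ℝ} {ψ : ℤ → ℂ}
    (h0 : Filter.Tendsto ψ Filter.cofinite (nhds 0))
    (h : ∀ j, ψ (j + 1) + ψ (j - 1) = 2 * ((M + if j = 0 then G else 0 : ℝ) : ℂ) * ψ j) :
    (∀ j, ψ j = 0) ∨ (M ^ 2 = G ^ 2 + 1 ∧ M * G < 0) := by
  obtain ⟨lam, hl0, hl1, hl⟩ := exists_root_norm_le_one M
  have hinj1 : Function.Injective (fun n : ℕ => (n : ℤ)) := fun _ _ h => by simpa using h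
  have hinj2 : Function.Injective (fun n : ℕ => -(n : ℤ)) := fun _ _ h => by simpa using h
  have lim1 := h0.comp hinj1.tendsto_cofinite
  have lim2 := h0.comp hinj2.tendsto_cofinite
  rw [Nat.cofinite_eq_atTop] at lim1 lim2
  have r1 : ∀ n : ℕ, ψ ((n + 1 : ℕ) : ℤ) = lam * ψ (n : ℤ) := by
    refine eq_mul_of_recurrence hl0 hl1 (fun n => ?_) lim1
    have := h ((n : ℤ) + 1)
    rw [if_neg (by omega), add_zero, add_sub_cancel_right, ← hl] at this
    simp only [Function.comp_apply]
    push_cast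
    rw [← this]
    ring_nf
  have r2 : ∀ n : ℕ, ψ (-((n + 1 : ℕ) : ℤ)) = lam * ψ (-(n : ℤ)) := by
    refine eq_mul_of_recurrence hl0 hl1 (fun n => ?_) lim2
    have := h (-((n : ℤ) + 1))
    rw [if_neg (by omega), add_zero, ← hl] at this
    simp only [Function.comp_apply]
    push_cast
    rw [← this]
    ring_nf
  have p1 : ∀ n : ℕ, ψ (n : ℤ) = lam ^ n * ψ 0 := fun n => by
    induction n with
    | zero => simp
    | succ n ih => rw [r1, ih]; ring
  have p2 : ∀ n : ℕ, ψ (-(n : ℤ)) = lam ^ n * ψ 0 := fun n => by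
    induction n with
    | zero => simp
    | succ n ih => rw [r2, ih]; ring
  by_cases hz : ψ 0 = 0
  · left
    intro j
    obtain ⟨n, rfl | rfl⟩ := Int.eq_nat_or_neg j
    · rw [p1, hz, mul_zero]
    · rw [p2, hz, mul_zero]
  right
  have hlt : ‖lam‖ < 1 := by
    have : Filter.Tendsto (fun n : ℕ => lam ^ n) Filter.atTop (nhds 0) := by
      have := lim1.mul_const (ψ 0)⁻¹
      rw [zero_mul] at this
      refine this.congr fun n => ?_
      simp only [Function.comp_apply]
      rw [p1, mul_assoc, mul_inv_cancel₀ hz, mul_one]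
    exact tendsto_pow_atTop_nhds_zero_iff_norm_lt_one.1 this
  have hc := h 0
  have e1 := p1 1
  have e2 := p2 1
  simp only [Nat.cast_one, pow_one] at e1 e2
  rw [if_pos rfl, zero_add, zero_sub, e1, e2] at hc
  -- Both neighbours of `0` carry `lam * ψ 0`, so the equation at `j = 0` reads `2 lam = 2 (M + G)`.
  have hlMG : lam = ((M + G : ℝ) : ℂ) := by
    refine mul_right_cancel₀ hz ?_
    linear_combination hc / 2
  have hprod : (M + G) * (M - G) = 1 := by
    have h1 : lam * lam⁻¹ = 1 := mul_inv_cancel₀ hl0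
    have h2 : lam⁻¹ = ((M - G : ℝ) : ℂ) := by
      push_cast
      push_cast at hlMG
      linear_combination hl - hlMG
    rw [h2, hlMG] at h1
    exact_mod_cast h1
  refine ⟨by linear_combination hprod, ?_⟩
  rw [hlMG, Complex.norm_real, Real.norm_eq_abs, ← sq_lt_one_iff_abs_lt_one] at hlt
  nlinarith [sq_nonneg (M + G), sq_nonneg (M - G)]

theorem memℓp_pow_natAbs {lam : ℝ} (h : |lam| < 1) :
    Memℓp (fun j : ℤ => ((lam ^ j.natAbs : ℝ) : ℂ)) 2 := by
  rw [memℓp_two_iff]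
  have hn : ∀ n : ℕ, ‖((lam ^ n : ℝ) : ℂ)‖ ^ 2 = (|lam| ^ 2) ^ n := fun n => by
    rw [Complex.norm_real, Real.norm_eq_abs, abs_pow]; ring
  simp only [hn]
  have hs := summable_geometric_of_lt_one (r := |lam| ^ 2) (by positivity)
    (by rw [sq_abs]; exact (sq_lt_one_iff_abs_lt_one lam).2 h)
  refine Summable.of_nat_of_neg ?_ ?_ <;> simpa using hs

/-- The hypothesis says that `M + G` and `M - G` have product `1`, so `M + G` is a root of `z² - 2 M
z + 1`. At `j = 0` both neighbours equal `M + G`, which accounts for the extra `G`. -/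
theorem pow_natAbs_recurrence {M G : ℝ} (h : M ^ 2 = G ^ 2 + 1) (j : ℤ) :
    (M + G) ^ (j + 1).natAbs + (M + G) ^ (j - 1).natAbs =
      2 * (M + if j = 0 then G else 0) * (M + G) ^ j.natAbs := by
  obtain ⟨n, rfl | rfl⟩ := Int.eq_nat_or_neg j
  · cases n with
    | zero => simp; ring
    | succ n =>
      rw [if_neg (by omega), show (((n + 1 : ℕ) : ℤ) + 1).natAbs = n + 2 by omega,
        show (((n + 1 : ℕ) : ℤ) - 1).natAbs = n by omega,
        show ((n + 1 : ℕ) : ℤ).natAbs = n + 1 by omega]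
      linear_combination (-(M + G) ^ n) * h
  · cases n with
    | zero => simp; ring
    | succ n =>
      rw [if_neg (by omega), show (-((n + 1 : ℕ) : ℤ) + 1).natAbs = n by omega,
        show (-((n + 1 : ℕ) : ℤ) - 1).natAbs = n + 2 by omega,
        show (-((n + 1 : ℕ) : ℤ)).natAbs = n + 1 by omega]
      linear_combination (-(M + G) ^ n) * h

/-! ## Eigenvalues of the fiber operators in the gaps -/

theorem IsW22Rep.trace_eq_zero {ℓ : ℝ} (hℓ : 0 < ℓ) {f f' : ℝ → ℂ} (h : IsW22Rep ℓ 0 0 f f') :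
    f 0 = 0 ∧ f' 0 = 0 := by
  obtain ⟨K, -, hK⟩ := exists_norm_trace_le hℓ
  simpa using hK _ _ _ _ h

theorem IsCombRep.trace_eq_zero {a b : ℝ} (ha : 0 < a) (hb : 0 < b) {f f' : CombEdge → ℝ → ℂ}
    (h : IsCombRep a b 0 0 f f') (e : CombEdge) : f e 0 = 0 ∧ f' e 0 = 0 :=
  IsW22Rep.trace_eq_zero (e.length_pos ha hb) (h e)

theorem mem_combHamiltonian_iff {a b : ℝ} (ha : 0 < a) (hb : 0 < b) {γ γt θ : ℝ}
    {u v : CombL2 a b} :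
    (∃ h : u ∈ (combHamiltonian a b γ γt θ).domain, combHamiltonian a b γ γt θ ⟨u, h⟩ = v) ↔
      ∃ f f' : CombEdge → ℝ → ℂ, IsCombRep a b u (-v) f f' ∧
        CombVertexConditions a b γ γt θ f f' := by
  have h1 : (u, v) ∈ (combHamiltonian a b γ γt θ).graph ↔ (u, v) ∈ combGraph a b γ γt θ := by
    rw [combHamiltonian_graph ha hb]
  have h2 : (u, v) ∈ combGraph a b γ γt θ ↔ ∃ f f' : CombEdge → ℝ → ℂ,
      IsCombRep a b u (-v) f f' ∧ CombVertexConditions a b γ γt θ f f' := Iff.rfl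
  rw [← h2, ← h1, LinearPMap.mem_graph_iff]
  constructor
  · rintro ⟨h, hv⟩
    exact ⟨⟨u, h⟩, rfl, hv⟩
  · rintro ⟨⟨x, hx⟩, rfl, hv⟩
    exact ⟨hx, hv⟩

open scoped InnerProductSpace in
theorem combHamiltonian_symmetric {a b : ℝ} (ha : 0 < a) (hb : 0 < b) (γ γt θ : ℝ)
    (x y : (combHamiltonian a b γ γt θ).domain) :
    ⟪combHamiltonian a b γ γt θ x, (y : CombL2 a b)⟫_ℂ =
      ⟪(x : CombL2 a b), combHamiltonian a b γ γt θ y⟫_ℂ := by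
  obtain ⟨f, f', hf, hvf⟩ := (mem_combHamiltonian_iff ha hb).1 ⟨x.2, rfl⟩
  obtain ⟨g, g', hg, hvg⟩ := (mem_combHamiltonian_iff ha hb).1 ⟨y.2, rfl⟩
  have := hg.green ha hb hf hvg hvf
  rw [sub_self, Complex.ofReal_zero, zero_mul, inner_neg_left, inner_neg_right, sub_neg_eq_add,
    neg_add_eq_zero] at this
  exact this.symm

namespace IsFundamentalSystem

variable {E : ℝ} {C S : ℝ → ℝ} {a b : ℝ}

/-- The inhomogeneity of the difference equation for the values at the internal vertices. -/
def vertexSource (E : ℝ) (C S : ℝ → ℝ) (θ : ℝ) (y : CombL2 a b) (j : ℤ) : ℂ :=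
  endValue C S (y (.rung (j + 1))) - C a * endValue C S (y (.rung j)) +
    S a * endDeriv E C S (y (.rung j)) +
    S a * ((1 - Complex.exp (-(Complex.I * θ)) * C b) *
      (C (b / 2) * endValue C S (y (.up j)) + S (b / 2) * endDeriv E C S (y (.up j)) +
        Complex.exp (Complex.I * θ) * endValue C S (y (.down j))) * (S b : ℂ)⁻¹ +
      Complex.exp (-(Complex.I * θ)) * (C (b / 2) * endDeriv E C S (y (.up j)) -
        E * S (b / 2) * endValue C S (y (.up j))) + endDeriv E C S (y (.down j)))

theorem memℓp_vertexSource (h : IsFundamentalSystem E C S) (ha : 0 < a) (hb : 0 < b) (θ : ℝ)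
    (y : CombL2 a b) : Memℓp (vertexSource E C S θ y) 2 := by
  obtain ⟨hv, hd⟩ := h.memℓp_endValue ha hb y
  have r := CombEdge.rung_injective
  have r1 : Function.Injective fun j : ℤ => CombEdge.rung (j + 1) :=
    r.comp (add_left_injective 1)
  have u := CombEdge.up_injective
  have d := CombEdge.down_injective
  have hu : Memℓp (fun j : ℤ => C (b / 2) * endValue C S (y (.up j)) +
      S (b / 2) * endDeriv E C S (y (.up j)) +
        Complex.exp (Complex.I * θ) * endValue C S (y (.down j))) 2 :=
    (((hv.comp_injective_two u).const_mul (C (b / 2) : ℂ)).add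
      ((hd.comp_injective_two u).const_mul (S (b / 2) : ℂ))).add
      ((hv.comp_injective_two d).const_mul (Complex.exp (Complex.I * θ)))
  have hz : Memℓp (fun j : ℤ => C (b / 2) * endDeriv E C S (y (.up j)) -
        E * S (b / 2) * endValue C S (y (.up j))) 2 :=
    ((hd.comp_injective_two u).const_mul (C (b / 2) : ℂ)).sub
      ((hv.comp_injective_two u).const_mul (E * S (b / 2) : ℂ))
  have key := (((hv.comp_injective_two r1).sub ((hv.comp_injective_two r).const_mul
    (C a : ℂ))).add ((hd.comp_injective_two r).const_mul (S a : ℂ))).add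
    ((((hu.const_mul ((1 - Complex.exp (-(Complex.I * θ)) * C b) * (S b : ℂ)⁻¹)).add
      (hz.const_mul (Complex.exp (-(Complex.I * θ))))).add (hd.comp_injective_two d)).const_mul
      (S a : ℂ))
  convert! key using 1
  funext j
  simp only [vertexSource, Pi.add_apply, Pi.sub_apply]
  ring

theorem vertexSource_zero (ha : 0 < a) (hb : 0 < b) (θ : ℝ) (j : ℤ) :
    vertexSource E C S θ (0 : CombL2 a b) j = 0 := by
  have hz : ∀ e : CombEdge, endValue C S ((0 : CombL2 a b) e) = 0 ∧
      endDeriv E C S ((0 : CombL2 a b) e) = 0 := fun e => endValue_zero (e.length_pos ha hb)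
  simp only [vertexSource, (hz _).1, (hz _).2, mul_zero, zero_mul, add_zero, sub_zero]

theorem C_complex (h : IsFundamentalSystem E C S) (b : ℝ) :
    (C b : ℂ) = (C (b / 2) : ℂ) ^ 2 - E * (S (b / 2) : ℂ) ^ 2 := by
  have := h.C_two_mul (b / 2)
  rw [mul_div_cancel₀ b two_ne_zero] at this
  exact_mod_cast this

theorem S_complex (h : IsFundamentalSystem E C S) (b : ℝ) :
    (S b : ℂ) = 2 * S (b / 2) * C (b / 2) := by
  have := h.S_two_mul (b / 2)
  rw [mul_div_cancel₀ b two_ne_zero] at this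
  exact_mod_cast this

/-- Reverses the elimination: the vertex values determine all initial data once one can divide by `S
a` and `S b`. The coupling `γ₀` at `x_0` is kept free, because eigenfunctions need `γt` there while
the inhomogeneous equation is solved with `γ`. -/
theorem exists_of_recurrence (h : IsFundamentalSystem E C S) (ha : 0 < a) (hb : 0 < b)
    (hSa : S a ≠ 0) (hSb : S b ≠ 0) (γ γ₀ θ : ℝ) (y : CombL2 a b) {ψ : ℤ → ℂ} (hψ : Memℓp ψ 2)
    (hrec : ∀ j, ψ (j + 1) + ψ (j - 1) - 2 * ((C a + S a * (C b - Real.cos θ) / S b +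
      (if j = 0 then γ₀ else γ) * S a / 2 : ℝ) : ℂ) * ψ j = vertexSource E C S θ y j) :
    ∃ (u : CombL2 a b) (f f' : CombEdge → ℝ → ℂ),
      IsCombRep a b u (-(y + (E : ℂ) • u)) f f' ∧ CombVertexConditions a b γ γ₀ θ f f' ∧
      ∀ j, f (.up j) 0 = ψ j := by
  obtain ⟨hv, hd⟩ := h.memℓp_endValue ha hb y
  set V : CombEdge → ℂ := fun e => endValue C S (y e) with hV
  set D : CombEdge → ℂ := fun e => endDeriv E C S (y e) with hD
  set ω := Complex.exp (Complex.I * θ) with hω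
  set ω' := Complex.exp (-(Complex.I * θ)) with hω'
  have hωω : ω * ω' = 1 := by rw [hω, hω', ← Complex.exp_add, add_neg_cancel, Complex.exp_zero]
  have hcos : ω + ω' = 2 * Real.cos θ := by
    rw [Complex.ofReal_cos, Complex.two_cos, hω, hω']
    congr 2 <;> ring
  have hia : (S a : ℂ)⁻¹ * S a = 1 := inv_mul_cancel₀ (by exact_mod_cast hSa)
  have hib : (S b : ℂ)⁻¹ * S b = 1 := inv_mul_cancel₀ (by exact_mod_cast hSb)
  have hsa := h.sq_add_sq_complex a
  have hsb := h.sq_add_sq_complex b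
  have hC := h.C_complex b
  have hS := h.S_complex b
  set q : ℤ → ℂ := fun j => C (b / 2) * V (.up j) + S (b / 2) * D (.up j) + ω * V (.down j) with hq
  -- The derivative at the start of the upper edge for which the solution, continued through the
  -- Floquet condition along the lower edge, returns to `ψ j`; `q` collects the source terms met on
  -- the way.
  set p : ℤ → ℂ := fun j => (S b : ℂ)⁻¹ * ((ω - C b) * ψ j - q j) with hp
  set up : ℤ → ℂ := fun j => C (b / 2) * ψ j + S (b / 2) * p j + V (.up j) with hup
  set up' : ℤ → ℂ := fun j => C (b / 2) * p j - E * S (b / 2) * ψ j + D (.up j) with hup'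
  set r : ℤ → ℂ := fun j => (S a : ℂ)⁻¹ * (ψ j - C a * ψ (j - 1) - V (.rung j)) with hr
  set α : CombEdge → ℂ := fun e => match e with
    | .rung j => ψ (j - 1)
    | .up j => ψ j
    | .down j => ω' * up j with hα
  set β : CombEdge → ℂ := fun e => match e with
    | .rung j => r j
    | .up j => p j
    | .down j => ω' * up' j with hβ
  have hVr := hv.comp_injective_two CombEdge.rung_injective
  have hVu := hv.comp_injective_two CombEdge.up_injective
  have hVd := hv.comp_injective_two CombEdge.down_injective
  have hDu := hd.comp_injective_two CombEdge.up_injective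
  have hψ1 : Memℓp (fun j => ψ (j - 1)) 2 := hψ.comp_injective_two (sub_left_injective (b := (1 : ℤ)))
  have mq : Memℓp q 2 := ((hVu.const_mul (C (b / 2) : ℂ)).add
    (hDu.const_mul (S (b / 2) : ℂ))).add (hVd.const_mul ω)
  have mp : Memℓp p 2 := ((hψ.const_mul (ω - C b)).sub mq).const_mul (S b : ℂ)⁻¹
  have mup : Memℓp up 2 := ((hψ.const_mul (C (b / 2) : ℂ)).add
    (mp.const_mul (S (b / 2) : ℂ))).add hVu
  have mup' : Memℓp up' 2 := ((mp.const_mul (C (b / 2) : ℂ)).sub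
    (hψ.const_mul (E * S (b / 2) : ℂ))).add hDu
  have mr : Memℓp r 2 := ((hψ.sub (hψ1.const_mul (C a : ℂ))).sub hVr).const_mul (S a : ℂ)⁻¹
  have mα : Memℓp α 2 := memℓp_combEdge hψ1 hψ (mup.const_mul ω')
  have mβ : Memℓp β 2 := memℓp_combEdge mr mp (mup'.const_mul ω')
  obtain ⟨u, f, f', hf, hfα, hfβ⟩ := h.exists_combRep y mα mβ
  have er0 : ∀ j, f (.rung j) 0 = ψ (j - 1) := fun j => hfα (.rung j)
  have er0' : ∀ j, f' (.rung j) 0 = r j := fun j => hfβ (.rung j)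
  have eu0 : ∀ j, f (.up j) 0 = ψ j := fun j => hfα (.up j)
  have eu0' : ∀ j, f' (.up j) 0 = p j := fun j => hfβ (.up j)
  have ed0 : ∀ j, f (.down j) 0 = ω' * up j := fun j => hfα (.down j)
  have ed0' : ∀ j, f' (.down j) 0 = ω' * up' j := fun j => hfβ (.down j)
  have er1 : ∀ j, f (.rung j) a = ψ j := fun j => by
    have : f (.rung j) a = C a * f (.rung j) 0 + S a * f' (.rung j) 0 + V (.rung j) :=
      (h.endpoint_eq ha hb hf (.rung j)).1
    rw [this, er0, er0', hr]
    linear_combination (ψ j - C a * ψ (j - 1) - V (.rung j)) * hia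
  have er1' : ∀ j, f' (.rung j) a =
      (S a : ℂ)⁻¹ * (C a * ψ j - ψ (j - 1) - C a * V (.rung j)) + D (.rung j) := fun j => by
    have : f' (.rung j) a = C a * f' (.rung j) 0 - E * S a * f (.rung j) 0 + D (.rung j) :=
      (h.endpoint_eq ha hb hf (.rung j)).2
    rw [this, er0, er0', hr]
    linear_combination (-(S a : ℂ)⁻¹ * ψ (j - 1)) * hsa + E * S a * ψ (j - 1) * hia
  have eu1 : ∀ j, f (.up j) (b / 2) = up j := fun j => by
    have : f (.up j) (b / 2) = C (b / 2) * f (.up j) 0 + S (b / 2) * f' (.up j) 0 + V (.up j) :=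
      (h.endpoint_eq ha hb hf (.up j)).1
    rw [this, eu0, eu0']
  have eu1' : ∀ j, f' (.up j) (b / 2) = up' j := fun j => by
    have : f' (.up j) (b / 2) =
        C (b / 2) * f' (.up j) 0 - E * S (b / 2) * f (.up j) 0 + D (.up j) :=
      (h.endpoint_eq ha hb hf (.up j)).2
    rw [this, eu0, eu0']
  have ed1 : ∀ j, f (.down j) (b / 2) = ψ j := fun j => by
    have : f (.down j) (b / 2) =
        C (b / 2) * f (.down j) 0 + S (b / 2) * f' (.down j) 0 + V (.down j) :=
      (h.endpoint_eq ha hb hf (.down j)).1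
    rw [this, ed0, ed0']
    have e1 : (C (b / 2) : ℂ) * (ω' * up j) + S (b / 2) * (ω' * up' j) + V (.down j) =
        ω' * (C b * ψ j + S b * p j + q j) := by
      rw [hC, hS]
      simp only [hup, hup', hq]
      linear_combination (-V (.down j)) * hωω
    rw [e1, hp]
    linear_combination ω' * ((ω - C b) * ψ j - q j) * hib + ψ j * hωω
  have ed1' : ∀ j, f' (.down j) (b / 2) = ω' * (C b * p j - E * S b * ψ j +
      (C (b / 2) * D (.up j) - E * S (b / 2) * V (.up j))) + D (.down j) := fun j => by
    have : f' (.down j) (b / 2) =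
        C (b / 2) * f' (.down j) 0 - E * S (b / 2) * f (.down j) 0 + D (.down j) :=
      (h.endpoint_eq ha hb hf (.down j)).2
    rw [this, ed0, ed0', hC, hS]
    simp only [hup, hup']
    ring
  refine ⟨u, f, f', hf, ⟨fun j => ?_, fun j => ?_, fun j => ?_, fun j => ?_, fun j => ?_,
    fun j => ?_⟩, eu0⟩
  · rw [er1, eu0]
  · rw [er0, eu0, add_sub_cancel_right]
  · rw [ed1, eu0]
  -- The delta condition is the recurrence divided by `S a`; the other vertex conditions hold by the
  -- choice of the initial data.
  · have hj := hrec j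
    simp only [vertexSource] at hj
    change _ = V (.rung (j + 1)) - C a * V (.rung j) + S a * D (.rung j) +
      S a * ((1 - ω' * C b) * q j * (S b : ℂ)⁻¹ +
      ω' * (C (b / 2) * D (.up j) - E * S (b / 2) * V (.up j)) + D (.down j)) at hj
    rw [er0', er1', eu0', ed1', eu0]
    simp only [hr, add_sub_cancel_right]
    push_cast at hj hcos ⊢
    set g : ℂ := ((if j = 0 then γ₀ else γ : ℝ) : ℂ) with hg
    set c := Complex.cos (θ : ℂ) with hc
    simp only [hp]
    linear_combination (S a : ℂ)⁻¹ * hj + (2 * (C b - c) * (S b : ℂ)⁻¹ * ψ j + g * ψ j +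
      D (.rung j) + (1 - ω' * C b) * q j * (S b : ℂ)⁻¹ +
      ω' * (C (b / 2) * D (.up j) - E * S (b / 2) * V (.up j)) + D (.down j)) * hia +
      (S b : ℂ)⁻¹ * ψ j * hcos - (S b : ℂ)⁻¹ * ψ j * C b * hωω +
      (S b : ℂ)⁻¹ * ψ j * ω' * hsb - ω' * E * S b * ψ j * hib
  · rw [eu1, ed0, ← mul_assoc, hωω, one_mul]
  · rw [eu1', ed0', ← mul_assoc, hωω, one_mul]

open scoped InnerProductSpace in
-- The eigenfunction has vertex values `(M + G) ^ |j|`, where `|M + G| < 1` because `(M + G) (M - G)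
-- = 1` and `M G < 0`. The range condition is verified by comparison with the unperturbed comb.
theorem mem_opDiscreteSpectrum (h : IsFundamentalSystem E C S) (ha : 0 < a) (hb : 0 < b)
    (hSa : S a ≠ 0) (hSb : S b ≠ 0) {γ γt θ M G : ℝ}
    (hM : M = C a + S a * (C b - Real.cos θ) / S b + γ * S a / 2)
    (hG : G = (γt - γ) * S a / 2) (hMG : M ^ 2 = G ^ 2 + 1) (hneg : M * G < 0) :
    (E : ℂ) ∈ opDiscreteSpectrum (combHamiltonian a b γ γt θ) := by
  have hG0 : G ≠ 0 := by rintro rfl; simp at hneg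
  have hprod : (M + G) * (M - G) = 1 := by linear_combination hMG
  have hlt : |M + G| < 1 := by
    rw [← sq_lt_one_iff_abs_lt_one]
    nlinarith [sq_nonneg (M + G), sq_nonneg (M - G)]
  have hM1 : 1 < |M| := by
    rw [← one_lt_sq_iff_one_lt_abs, hMG]
    have := sq_pos_of_ne_zero hG0
    linarith
  obtain ⟨φ, g, g', hg, hvg, hg0⟩ := h.exists_of_recurrence ha hb hSa hSb γ γt θ 0
    (memℓp_pow_natAbs hlt) (fun j => by
      rw [vertexSource_zero ha hb, sub_eq_zero]
      have hrec := pow_natAbs_recurrence hMG j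
      have hc : C a + S a * (C b - Real.cos θ) / S b + (if j = 0 then γt else γ) * S a / 2 =
          M + if j = 0 then G else 0 := by
        rw [hM, hG]; split_ifs <;> ring
      rw [hc]
      exact_mod_cast hrec)
  rw [zero_add] at hg
  obtain ⟨hφ, hAφ⟩ := (mem_combHamiltonian_iff ha hb).2 ⟨g, g', hg, hvg⟩
  have hg00 : g (.up 0) 0 = 1 := by rw [hg0]; simp
  refine mem_opDiscreteSpectrum_of_symmetric _ (combHamiltonian_symmetric ha hb γ γt θ) E
    ⟨φ, hφ⟩ ?_ hAφ fun y hy => ?_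
  · intro hzero
    have hφ0 : φ = 0 := congrArg Subtype.val hzero
    rw [hφ0, smul_zero, neg_zero] at hg
    exact one_ne_zero (hg00.symm.trans (hg.trace_eq_zero ha hb (.up 0)).1)
  · obtain ⟨ψ, hψ, hrec⟩ := exists_solution_of_one_lt_abs hM1 (h.memℓp_vertexSource ha hb θ y)
    obtain ⟨u, f, f', hf, hvf, -⟩ := h.exists_of_recurrence ha hb hSa hSb γ γ θ y hψ (fun j => by
      rw [← hrec j, ite_self, hM])
    -- Here `u` solves the equation with coupling `γ` at `x_0`, while `φ` satisfies the condition
    -- with `γt`. Since `y ⊥ φ` and `φ(x_0) = 1`, the identity reduces to `(γt - γ) u(x_0) = 0`.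
    have hgreen := hf.green ha hb hg hvf hvg
    simp only at hy
    rw [inner_neg_right, inner_neg_left, inner_add_right, hy, inner_smul_left, inner_smul_right,
      Complex.conj_ofReal, hg00, star_one, one_mul, zero_add, sub_neg_eq_add, neg_add_cancel,
      eq_comm, mul_eq_zero] at hgreen
    have hγ : ((γt - γ : ℝ) : ℂ) ≠ 0 := by
      rw [Ne, Complex.ofReal_eq_zero]
      intro h0
      exact hG0 (by rw [hG, h0]; ring)
    have hu0 := hgreen.resolve_left hγ
    -- For a function vanishing at `x_0` the coupling constant there is irrelevant.
    have hvf' : CombVertexConditions a b γ γt θ f f' := by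
      refine ⟨hvf.cont_rung, hvf.cont_rung_succ, hvf.cont_down, fun j => ?_, hvf.floquet,
        hvf.floquet_deriv⟩
      rw [hvf.delta j]
      by_cases hj : j = 0
      · rw [hj, hu0, mul_zero, mul_zero]
      · rw [if_neg hj, if_neg hj]
    obtain ⟨hu, hAu⟩ := (mem_combHamiltonian_iff ha hb).2 ⟨f, f', hf, hvf'⟩
    exact ⟨⟨u, hu⟩, by rw [hAu]; exact add_sub_cancel_right _ _⟩

end IsFundamentalSystem

/-! ## The discrete spectrum of the fiber operators -/

theorem memℓp_single_two (j : ℤ) (c : ℂ) : Memℓp (Pi.single j c : ℤ → ℂ) 2 := by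
  have := lp.memℓp (lp.single (E := fun _ : ℤ => ℂ) 2 j c)
  rwa [lp.coeFn_single] at this

theorem eq_zero_of_norm_succ_eq {ψ : ℤ → ℂ} (h : ∀ j, ‖ψ (j + 1)‖ = ‖ψ j‖)
    (h0 : Filter.Tendsto ψ Filter.cofinite (nhds 0)) (j : ℤ) : ψ j = 0 := by
  have hinj : Function.Injective (fun n : ℕ => j + (n : ℤ)) := fun _ _ h => by simpa using h
  have lim := (tendsto_zero_iff_norm_tendsto_zero.1 h0).comp hinj.tendsto_cofinite
  rw [Nat.cofinite_eq_atTop] at lim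
  have hconst : ∀ n : ℕ, ‖ψ (j + (n : ℤ))‖ = ‖ψ j‖ := fun n => by
    induction n with
    | zero => simp
    | succ n ih => rw [← ih, ← h (j + n), Nat.cast_succ, add_assoc]
  have := tendsto_nhds_unique (tendsto_const_nhds (x := ‖ψ j‖)) (lim.congr hconst)
  exact norm_eq_zero.1 this

namespace IsFundamentalSystem

variable {E : ℝ} {C S : ℝ → ℝ} {a b γ γt θ : ℝ}

theorem eq_zero_of_trace (h : IsFundamentalSystem E C S) {ℓ : ℝ} {u : EdgeL2 ℓ} {f f' : ℝ → ℂ}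
    (hf : IsW22Rep ℓ u (-(0 + (E : ℂ) • u)) f f') (h0 : f 0 = 0) (h0' : f' 0 = 0) : u = 0 := by
  rw [Lp.eq_zero_iff_ae_eq_zero]
  filter_upwards [hf.ae_eq, ae_restrict_mem measurableSet_Ioc] with t h1 h2
  have hint : ∀ q : ℝ → ℂ, ∫ s in (0 : ℝ)..t, q s * (0 : EdgeL2 ℓ) s = 0 := fun q => by
    rw [intervalIntegral.integral_of_le h2.1.le]
    refine integral_eq_zero_of_ae ?_
    filter_upwards [ae_mono (Measure.restrict_mono (Ioc_subset_Ioc_right h2.2) le_rfl)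
      (Lp.coeFn_zero ℂ 2 (volume.restrict (Ioc (0 : ℝ) ℓ)))] with s hs
    rw [hs, Pi.zero_apply, mul_zero]
  rw [h1, (h.solution_eq hf ⟨h2.1.le, h2.2⟩).1, h0, h0', hint, hint]
  simp

theorem homogeneous_endpoint_eq (h : IsFundamentalSystem E C S) (ha : 0 < a) (hb : 0 < b)
    {u : CombL2 a b} {f f' : CombEdge → ℝ → ℂ}
    (hf : IsCombRep a b u (-(0 + (E : ℂ) • u)) f f') (e : CombEdge) :
    f e (e.length a b) = C (e.length a b) * f e 0 + S (e.length a b) * f' e 0 ∧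
      f' e (e.length a b) = C (e.length a b) * f' e 0 - E * S (e.length a b) * f e 0 := by
  have h1 := h.endpoint_eq ha hb hf e
  have h2 : endValue C S ((0 : CombL2 a b) e) = 0 := (endValue_zero (E := E) (e.length_pos ha hb)).1
  have h3 : endDeriv E C S ((0 : CombL2 a b) e) = 0 := (endValue_zero (E := E) (e.length_pos ha hb)).2
  rwa [h2, h3, add_zero, add_zero] at h1

/-- The algebraic relations between the initial data of an eigenfunction. -/
theorem eigenfunction_relations (h : IsFundamentalSystem E C S) (ha : 0 < a) (hb : 0 < b)
    {u : CombL2 a b} {f f' : CombEdge → ℝ → ℂ}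
    (hf : IsCombRep a b u (-(0 + (E : ℂ) • u)) f f')
    (hv : CombVertexConditions a b γ γt θ f f') (j : ℤ) :
    f (.up j) 0 = C a * f (.up (j - 1)) 0 + S a * f' (.rung j) 0 ∧
    (Complex.exp (Complex.I * θ) - C b) * f (.up j) 0 = S b * f' (.up j) 0 ∧
    f' (.rung (j + 1)) 0 - (C a * f' (.rung j) 0 - E * S a * f (.up (j - 1)) 0) + f' (.up j) 0 -
      Complex.exp (-(Complex.I * θ)) * (C b * f' (.up j) 0 - E * S b * f (.up j) 0) =
      ((if j = 0 then γt else γ : ℝ) : ℂ) * f (.up j) 0 := by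
  have hωω : Complex.exp (Complex.I * θ) * Complex.exp (-(Complex.I * θ)) = 1 := by
    rw [← Complex.exp_add, add_neg_cancel, Complex.exp_zero]
  have er := h.homogeneous_endpoint_eq ha hb hf (.rung j)
  have eu := h.homogeneous_endpoint_eq ha hb hf (.up j)
  have ed := h.homogeneous_endpoint_eq ha hb hf (.down j)
  simp only [CombEdge.length] at er eu ed
  have hC := h.C_complex b
  have hS := h.S_complex b
  have h0 := hv.cont_rung_succ (j - 1)
  rw [sub_add_cancel] at h0
  have h1 := hv.cont_rung j
  have h2 := hv.cont_down j
  have h3 := hv.delta j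
  have h4 := hv.floquet j
  have h5 := hv.floquet_deriv j
  rw [er.1, h0] at h1
  rw [er.2, ed.2, h0] at h3
  rw [ed.1] at h2
  rw [eu.1] at h4
  rw [eu.2] at h5
  refine ⟨h1.symm, ?_, ?_⟩
  · rw [hC, hS]
    linear_combination (-Complex.exp (Complex.I * θ)) * h2 - C (b / 2) * h4 - S (b / 2) * h5
  · rw [← h3, hC, hS]
    linear_combination (-(C (b / 2) * f' (.down j) 0 - E * S (b / 2) * f (.down j) 0)) * hωω +
      (-Complex.exp (-(Complex.I * θ))) * (C (b / 2) * h5 - E * S (b / 2) * h4)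

/-- Construction of eigenfunctions vanishing at the internal vertices. -/
theorem exists_eigenfunction (h : IsFundamentalSystem E C S) (ha : 0 < a) (hb : 0 < b)
    {r p : ℤ → ℂ} (hr : Memℓp r 2) (hp : Memℓp p 2) (hr0 : ∀ j, S a * r j = 0)
    (hp0 : ∀ j, S b * p j = 0)
    (hd : ∀ j, r (j + 1) - C a * r j + (1 - Complex.exp (-(Complex.I * θ)) * C b) * p j = 0) :
    ∃ (u : CombL2 a b) (f f' : CombEdge → ℝ → ℂ), IsCombRep a b u (-(0 + (E : ℂ) • u)) f f' ∧
      CombVertexConditions a b γ γt θ f f' ∧ (∀ j, f (.rung j) 0 = 0 ∧ f' (.rung j) 0 = r j) ∧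
      (∀ j, f (.up j) 0 = 0 ∧ f' (.up j) 0 = p j) := by
  set ω := Complex.exp (Complex.I * θ) with hω
  set ω' := Complex.exp (-(Complex.I * θ)) with hω'
  have hωω : ω * ω' = 1 := by rw [hω, hω', ← Complex.exp_add, add_neg_cancel, Complex.exp_zero]
  set α : CombEdge → ℂ := fun e => match e with
    | .rung _ => 0
    | .up _ => 0
    | .down j => ω' * S (b / 2) * p j with hα
  set β : CombEdge → ℂ := fun e => match e with
    | .rung j => r j
    | .up j => p j
    | .down j => ω' * C (b / 2) * p j with hβ
  have mα : Memℓp α 2 := memℓp_combEdge zero_memℓp zero_memℓp (hp.const_mul (ω' * S (b / 2)))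
  have mβ : Memℓp β 2 := memℓp_combEdge hr hp (hp.const_mul (ω' * C (b / 2)))
  obtain ⟨u, f, f', hf, hfα, hfβ⟩ := h.exists_combRep 0 mα mβ
  have er0 : ∀ j, f (.rung j) 0 = 0 := fun j => hfα (.rung j)
  have er0' : ∀ j, f' (.rung j) 0 = r j := fun j => hfβ (.rung j)
  have eu0 : ∀ j, f (.up j) 0 = 0 := fun j => hfα (.up j)
  have eu0' : ∀ j, f' (.up j) 0 = p j := fun j => hfβ (.up j)
  have ed0 : ∀ j, f (.down j) 0 = ω' * S (b / 2) * p j := fun j => hfα (.down j)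
  have ed0' : ∀ j, f' (.down j) 0 = ω' * C (b / 2) * p j := fun j => hfβ (.down j)
  have hC := h.C_complex b
  have hS := h.S_complex b
  have er := fun j => h.homogeneous_endpoint_eq ha hb hf (.rung j)
  have eu := fun j => h.homogeneous_endpoint_eq ha hb hf (.up j)
  have ed := fun j => h.homogeneous_endpoint_eq ha hb hf (.down j)
  simp only [CombEdge.length, er0, er0', eu0, eu0', ed0, ed0'] at er eu ed
  refine ⟨u, f, f', hf, ⟨fun j => ?_, fun j => ?_, fun j => ?_, fun j => ?_, fun j => ?_,
    fun j => ?_⟩, fun j => ⟨er0 j, er0' j⟩, fun j => ⟨eu0 j, eu0' j⟩⟩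
  · rw [(er j).1, eu0]
    linear_combination hr0 j
  · rw [er0, eu0]
  · have := hp0 j
    rw [hS] at this
    rw [(ed j).1, eu0]
    linear_combination ω' * this
  · have := hd j
    rw [hC] at this
    rw [(er j).2, (ed j).2, er0', eu0, eu0']
    linear_combination this
  · rw [(eu j).1, ed0]
    linear_combination (-(S (b / 2) * p j)) * hωω
  · rw [(eu j).2, ed0']
    linear_combination (-(C (b / 2) * p j)) * hωω

/-- Infinitely many eigenfunctions which are localized on different edges. -/
theorem not_finiteDimensional_opEigenspace (h : IsFundamentalSystem E C S) (ha : 0 < a)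
    (hb : 0 < b) (ε : ℤ → CombEdge)
    (hε : ∀ j, ∃ (u : CombL2 a b) (f f' : CombEdge → ℝ → ℂ),
      IsCombRep a b u (-(0 + (E : ℂ) • u)) f f' ∧ CombVertexConditions a b γ γt θ f f' ∧
      ∀ i, f (ε i) 0 = 0 ∧ f' (ε i) 0 = (Pi.single j 1 : ℤ → ℂ) i) :
    ¬FiniteDimensional ℂ (opEigenspace (combHamiltonian a b γ γt θ) E) := by
  intro hfin
  choose u f f' hf hv hT using hε
  have hmem : ∀ j, u j ∈ opEigenspace (combHamiltonian a b γ γt θ) E := fun j => by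
    refine mem_opEigenspace.2 ((mem_combHamiltonian_iff ha hb).2 ⟨f j, f' j, ?_, hv j⟩)
    have := hf j
    rwa [zero_add] at this
  -- Zero initial data force `u j` to vanish on the marked edge `ε i`. Restriction to marked edges
  -- thus diagonalizes the family, giving linear independence.
  have hoff : ∀ i j, i ≠ j → u j (ε i) = 0 := fun i j hij =>
    h.eq_zero_of_trace (hf j (ε i)) (hT j i).1 (by rw [(hT j i).2, Pi.single_eq_of_ne hij])
  have hdiag : ∀ i, u i (ε i) ≠ 0 := fun i hi => by
    have h1 : IsW22Rep _ (u i (ε i)) (-(0 + (E : ℂ) • u i (ε i))) _ _ := hf i (ε i)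
    rw [hi, smul_zero, add_zero, neg_zero] at h1
    have h2 := (h1.trace_eq_zero ((ε i).length_pos ha hb)).2
    rw [(hT i i).2, Pi.single_eq_same] at h2
    exact one_ne_zero h2
  have hli : LinearIndependent ℂ u := by
    rw [linearIndependent_iff']
    intro s c hc i hi
    have h1 := congrArg (fun v : CombL2 a b => v (ε i)) hc
    simp only [lp.coeFn_sum, Finset.sum_apply, lp.coeFn_smul, Pi.smul_apply] at h1
    rw [Finset.sum_eq_single i (fun j _ hj => by rw [hoff i j hj.symm, smul_zero])
      (fun hn => absurd hi hn)] at h1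
    exact (smul_eq_zero.1 h1).resolve_right (hdiag i)
  have hli' : LinearIndependent ℂ (fun j =>
      (⟨u j, hmem j⟩ : opEigenspace (combHamiltonian a b γ γt θ) E)) :=
    LinearIndependent.of_comp (Submodule.subtype _) hli
  have := hli'.finite
  exact not_finite ℤ

/-- The degenerate values `S a = 0` and `S b = 0` are excluded because the eigenspace is nonzero and
of finite dimension. In the remaining case the vertex values satisfy the three-term recurrence and
decay. -/
theorem of_mem_opDiscreteSpectrum (h : IsFundamentalSystem E C S) (ha : 0 < a) (hb : 0 < b)
    (hE : (E : ℂ) ∈ opDiscreteSpectrum (combHamiltonian a b γ γt θ)) {M G : ℝ}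
    (hM : M = C a + S a * (C b - Real.cos θ) / S b + γ * S a / 2)
    (hG : G = (γt - γ) * S a / 2) :
    S b ≠ 0 ∧ M ^ 2 = G ^ 2 + 1 ∧ M * G < 0 := by
  obtain ⟨hne, hfin, -⟩ := hE
  obtain ⟨u, hu, hu0⟩ := Submodule.exists_mem_ne_zero_of_ne_bot hne
  obtain ⟨f, f', hf, hv⟩ := (mem_combHamiltonian_iff ha hb).1 (mem_opEigenspace.1 hu)
  rw [← zero_add ((E : ℂ) • u)] at hf
  have hrel := h.eigenfunction_relations ha hb hf hv
  set ω := Complex.exp (Complex.I * θ) with hω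
  set ω' := Complex.exp (-(Complex.I * θ)) with hω'
  have hωω : ω * ω' = 1 := by rw [hω, hω', ← Complex.exp_add, add_neg_cancel, Complex.exp_zero]
  have htr := hf.memℓp_trace ha hb
  have hψlim := (htr.1.comp_injective_two CombEdge.up_injective).tendsto_zero_two
  have hrlim := (htr.2.comp_injective_two CombEdge.rung_injective).tendsto_zero_two
  have hvanish : (∀ j, f (.up j) 0 = 0) → (∀ j, f' (.rung j) 0 = 0) → (∀ j, f' (.up j) 0 = 0) →
      False := by
    intro h1 h2 h3
    refine hu0 ?_
    ext1
    funext e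
    refine h.eq_zero_of_trace (hf e) ?_ ?_
    · match e with
      | .rung j =>
        have := hv.cont_rung_succ (j - 1)
        rwa [sub_add_cancel, h1] at this
      | .up j => exact h1 j
      | .down j =>
        have e1 := hv.floquet j
        have e2 := (h.homogeneous_endpoint_eq ha hb hf (.up j)).1
        simp only [CombEdge.length, h1, h3, mul_zero, add_zero] at e2
        rw [e2, eq_comm] at e1
        exact (mul_eq_zero.1 e1).resolve_left (Complex.exp_ne_zero _)
    · match e with
      | .rung j => exact h2 j
      | .up j => exact h3 j
      | .down j =>
        have e1 := hv.floquet_deriv j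
        have e2 := (h.homogeneous_endpoint_eq ha hb hf (.up j)).2
        simp only [CombEdge.length, h1, h3, mul_zero, sub_zero] at e2
        rw [e2, eq_comm] at e1
        exact (mul_eq_zero.1 e1).resolve_left (Complex.exp_ne_zero _)
  by_cases hSb : S b = 0
  · exfalso
    have hSb' : (S b : ℂ) = 0 := by rw [hSb, Complex.ofReal_zero]
    -- Here a sine on a single vertical pair of edges is already quasiperiodic and satisfies the
    -- delta condition, so every `x_j` carries its own eigenfunction.
    by_cases hωC : ω = C b
    · refine h.not_finiteDimensional_opEigenspace ha hb CombEdge.up (fun j => ?_) hfin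
      obtain ⟨v, g, g', hg, hvg, -, hT⟩ := h.exists_eigenfunction (γ := γ) (γt := γt) (θ := θ) ha hb
        (r := 0) zero_memℓp (memℓp_single_two j 1) (fun i => by simp)
        (fun i => by rw [hSb', zero_mul])
        (fun i => by rw [← hω', ← hωC, mul_comm ω', hωω]; simp)
      exact ⟨v, g, g', hg, hvg, hT⟩
    have hψ : ∀ j, f (.up j) 0 = 0 := fun j => by
      have := (hrel j).2.1
      rw [hSb', zero_mul] at this
      exact (mul_eq_zero.1 this).resolve_left (sub_ne_zero.2 hωC)
    have hne : 1 - ω' * C b ≠ 0 := fun h0 => hωC (by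
      linear_combination ω * h0 + C b * hωω)
    -- A sine on one rung can be balanced at its two end vertices by sines on the vertical edges,
    -- with amplitudes `p` obtained by dividing by `1 - ω' * C b`.
    by_cases hSa : S a = 0
    · have hSa' : (S a : ℂ) = 0 := by rw [hSa, Complex.ofReal_zero]
      refine h.not_finiteDimensional_opEigenspace ha hb CombEdge.rung (fun j => ?_) hfin
      have hs := memℓp_single_two j 1
      obtain ⟨v, g, g', hg, hvg, hT, -⟩ := h.exists_eigenfunction (γ := γ) (γt := γt) (θ := θ) ha hb
        (r := Pi.single j 1) (p := fun i => (1 - ω' * C b)⁻¹ *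
          (C a * (Pi.single j 1 : ℤ → ℂ) i - (Pi.single j 1 : ℤ → ℂ) (i + 1))) hs
        (((hs.const_mul (C a : ℂ)).sub
          (hs.comp_injective_two (add_left_injective 1))).const_mul _)
        (fun i => by rw [hSa', zero_mul]) (fun i => by rw [hSb', zero_mul])
        (fun i => by rw [← hω', mul_inv_cancel_left₀ hne]; ring)
      exact ⟨v, g, g', hg, hvg, hT⟩
    · have hSa' : (S a : ℂ) ≠ 0 := by exact_mod_cast hSa
      have hr : ∀ j, f' (.rung j) 0 = 0 := fun j => by
        have := (hrel j).1
        rw [hψ, hψ, mul_zero, zero_add, eq_comm] at this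
        exact (mul_eq_zero.1 this).resolve_left hSa'
      refine hvanish hψ hr fun j => ?_
      have := (hrel j).2.2
      rw [hr, hr, hψ, hψ] at this
      refine (mul_eq_zero.1 ?_).resolve_left hne
      linear_combination this
  refine ⟨hSb, ?_⟩
  have hSb' : (S b : ℂ) ≠ 0 := by exact_mod_cast hSb
  have hp : (∀ j, f (.up j) 0 = 0) → ∀ j, f' (.up j) 0 = 0 := fun hψ j => by
    have := (hrel j).2.1
    rw [hψ, mul_zero, eq_comm] at this
    exact (mul_eq_zero.1 this).resolve_left hSb'
  -- Now `C a = ±1`, so vertex values have constant modulus along the chain and must vanish by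
  -- decay; the same then holds for the rung derivatives.
  by_cases hSa : S a = 0
  · exfalso
    have hSa' : (S a : ℂ) = 0 := by rw [hSa, Complex.ofReal_zero]
    have hCa : ‖(C a : ℂ)‖ = 1 := by
      have := h.sq_add_sq a
      rw [hSa] at this
      rw [Complex.norm_real, Real.norm_eq_abs, ← abs_one, ← sq_eq_sq_iff_abs_eq_abs]
      linarith
    have hψ : ∀ j, f (.up j) 0 = 0 := eq_zero_of_norm_succ_eq (fun j => by
      rw [(hrel (j + 1)).1, hSa', zero_mul, add_zero, norm_mul, hCa, one_mul,
        add_sub_cancel_right]) hψlim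
    have hr : ∀ j, f' (.rung j) 0 = 0 := eq_zero_of_norm_succ_eq (fun j => by
      have := (hrel j).2.2
      rw [hp hψ, hψ, hψ] at this
      have h1 : f' (.rung (j + 1)) 0 = C a * f' (.rung j) 0 := by linear_combination this
      rw [h1, norm_mul, hCa, one_mul]) hrlim
    exact hvanish hψ hr (hp hψ)
  have hSa' : (S a : ℂ) ≠ 0 := by exact_mod_cast hSa
  have hcos : ω + ω' = 2 * Real.cos θ := by
    rw [Complex.ofReal_cos, Complex.two_cos, hω, hω']
    congr 2 <;> ring
  have hib : (S b : ℂ)⁻¹ * S b = 1 := inv_mul_cancel₀ hSb'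
  have hsa := h.sq_add_sq_complex a
  have hsb := h.sq_add_sq_complex b
  refine (eq_zero_or_of_recurrence (M := M) (G := G) hψlim fun j => ?_).resolve_left fun hψ => ?_
  · obtain ⟨r1, r2, r3⟩ := hrel j
    have r4 := (hrel (j + 1)).1
    rw [add_sub_cancel_right] at r4
    have hMG : M + (if j = 0 then G else 0) = C a + S a * (C b - Real.cos θ) * (S b)⁻¹ +
        (if j = 0 then γt else γ) * S a / 2 := by
      rw [hM, hG, div_eq_mul_inv _ (S b)]; split_ifs <;> ring
    rw [hMG]
    have hp' : f' (.up j) 0 = (S b : ℂ)⁻¹ * (ω - C b) * f (.up j) 0 := by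
      linear_combination (-(S b : ℂ)⁻¹) * r2 - f' (.up j) 0 * hib
    rw [hp'] at r3
    push_cast at r3 hcos ⊢
    linear_combination r4 + S a * r3 - C a * r1 - f (.up (j - 1)) 0 * hsa -
      S a * (S b : ℂ)⁻¹ * f (.up j) 0 * hcos + S a * (S b : ℂ)⁻¹ * f (.up j) 0 * C b * hωω -
      S a * (S b : ℂ)⁻¹ * f (.up j) 0 * ω' * hsb + S a * ω' * E * S b * f (.up j) 0 * hib
  · refine hvanish hψ (fun j => ?_) (hp hψ)
    have := (hrel j).1
    rw [hψ, hψ, mul_zero, zero_add, eq_comm] at this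
    exact (mul_eq_zero.1 this).resolve_left hSa'

end IsFundamentalSystem

/-! ## The band conditions in terms of the coupling constants -/

namespace IsFundamentalSystem

/-- Separates the `θ`-dependence of `M`, which is affine in `cos θ`. No condition on `S a` appears,
since `S a = 0` gives `G = 0`, contrary to the strict inequality. -/
theorem mem_bandSet_iff {E : ℝ} {C S : ℝ → ℝ} (h : IsFundamentalSystem E C S) {a b : ℝ}
    (ha : 0 < a) (hb : 0 < b) (γ γt : ℝ) {G : ℝ} (hG : G = (γt - γ) * S a / 2) :
    E ∈ bandSet a b γ γt ↔ S b ≠ 0 ∧ ∃ θ ∈ Icc (-Real.pi) Real.pi,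
      ((C a + S a * C b / S b + γ * S a / 2) - S a / S b * Real.cos θ) ^ 2 = G ^ 2 + 1 ∧
      ((C a + S a * C b / S b + γ * S a / 2) - S a / S b * Real.cos θ) * G < 0 := by
  have hM : ∀ θ : ℝ, (C a + S a * C b / S b + γ * S a / 2) - S a / S b * Real.cos θ =
      C a + S a * (C b - Real.cos θ) / S b + γ * S a / 2 := fun θ => by ring
  constructor
  · rintro ⟨θ, hθ, hE⟩
    obtain ⟨h1, h2⟩ := h.of_mem_opDiscreteSpectrum ha hb hE (hM θ) hG
    exact ⟨h1, θ, hθ, h2⟩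
  · rintro ⟨hSb, θ, hθ, h1, h2⟩
    refine ⟨θ, hθ, h.mem_opDiscreteSpectrum ha hb ?_ hSb (hM θ) hG h1 h2⟩
    intro h0
    rw [hG, h0] at h2
    simp at h2

/-! ### Fundamental systems for positive and negative energies -/

theorem cos_sin {k : ℝ} (hk : k ≠ 0) :
    IsFundamentalSystem (k ^ 2) (fun x => Real.cos (k * x)) (fun x => Real.sin (k * x) / k) where
  C_zero := by simp
  S_zero := by simp
  hasDerivAt_C x := by
    convert! ((hasDerivAt_id' x).const_mul k).cos using 1
    field_simp
  hasDerivAt_S x := by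
    convert! (((hasDerivAt_id' x).const_mul k).sin).div_const k using 1
    field_simp
  sq_add_sq x := by
    field_simp
    exact Real.cos_sq_add_sin_sq _
  S_two_mul x := by
    rw [show k * (2 * x) = 2 * (k * x) by ring, Real.sin_two_mul]
    ring
  C_two_mul x := by
    rw [show k * (2 * x) = 2 * (k * x) by ring, Real.cos_two_mul']
    field_simp

theorem cosh_sinh {κ : ℝ} (hκ : κ ≠ 0) :
    IsFundamentalSystem (-κ ^ 2) (fun x => Real.cosh (κ * x))
      (fun x => Real.sinh (κ * x) / κ) where
  C_zero := by simp
  S_zero := by simp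
  hasDerivAt_C x := by
    convert! ((hasDerivAt_id' x).const_mul κ).cosh using 1
    field_simp
  hasDerivAt_S x := by
    convert! (((hasDerivAt_id' x).const_mul κ).sinh).div_const κ using 1
    field_simp
  sq_add_sq x := by
    field_simp
    linarith [Real.cosh_sq_sub_sinh_sq (κ * x)]
  S_two_mul x := by
    rw [show κ * (2 * x) = 2 * (κ * x) by ring, Real.sinh_two_mul]
    ring
  C_two_mul x := by
    rw [show κ * (2 * x) = 2 * (κ * x) by ring, Real.cosh_two_mul]
    field_simp
    ring

end IsFundamentalSystem

/-! ### Solving for the quasimomentum -/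

theorem exists_mul_cos_eq {ρ t : ℝ} (h : |t| ≤ |ρ|) :
    ∃ θ ∈ Icc (-Real.pi) Real.pi, ρ * Real.cos θ = t := by
  refine ⟨Real.arccos (t / ρ), ⟨?_, Real.arccos_le_pi _⟩, ?_⟩
  · linarith [Real.pi_pos, Real.arccos_nonneg (t / ρ)]
  -- For `ρ = 0` the hypothesis forces `t = 0`, and any angle works.
  · by_cases hρ : ρ = 0
    · rw [hρ, abs_zero, abs_nonpos_iff] at h
      rw [hρ, h, zero_mul]
    · have h1 : |t / ρ| ≤ 1 := by
        rw [abs_div]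
        exact div_le_one_of_le₀ h (abs_nonneg ρ)
      rw [Real.cos_arccos (abs_le.1 h1).1 (abs_le.1 h1).2, mul_div_cancel₀ t hρ]

/-- The two conditions say that `A - ρ cos θ` is the square root taken with the sign opposite to
`G`, and `ρ cos θ` ranges exactly over `[-|ρ|, |ρ|]`. -/
theorem exists_band_parameter_iff (A ρ G : ℝ) :
    (∃ θ ∈ Icc (-Real.pi) Real.pi,
      (A - ρ * Real.cos θ) ^ 2 = G ^ 2 + 1 ∧ (A - ρ * Real.cos θ) * G < 0) ↔
    (|A + √(G ^ 2 + 1)| ≤ |ρ| ∧ 0 < G) ∨ (|A - √(G ^ 2 + 1)| ≤ |ρ| ∧ G < 0) := by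
  have hs : 0 < √(G ^ 2 + 1) := Real.sqrt_pos.2 (by positivity)
  have hs2 : √(G ^ 2 + 1) ^ 2 = G ^ 2 + 1 := Real.sq_sqrt (by positivity)
  have hle : ∀ θ : ℝ, |ρ * Real.cos θ| ≤ |ρ| := fun θ => by
    rw [abs_mul]
    exact mul_le_of_le_one_right (abs_nonneg _) (Real.abs_cos_le_one θ)
  constructor
  · rintro ⟨θ, -, h1, h2⟩
    rcases mul_neg_iff.1 h2 with ⟨hM, hG⟩ | ⟨hM, hG⟩
    · right
      have : √(G ^ 2 + 1) = A - ρ * Real.cos θ := by rw [← h1, Real.sqrt_sq hM.le]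
      rw [this, sub_sub_cancel]
      exact ⟨hle θ, hG⟩
    · left
      have : √(G ^ 2 + 1) = -(A - ρ * Real.cos θ) := by
        rw [← h1, Real.sqrt_sq_eq_abs, abs_of_neg hM]
      rw [this, ← sub_eq_add_neg, sub_sub_cancel]
      exact ⟨hle θ, hG⟩
  · rintro (⟨h1, hG⟩ | ⟨h1, hG⟩) <;> obtain ⟨θ, hθ, hc⟩ := exists_mul_cos_eq h1 <;>
      refine ⟨θ, hθ, ?_⟩
    · rw [hc, sub_add_cancel_left, neg_sq]
      exact ⟨hs2, mul_neg_of_neg_of_pos (neg_neg_of_pos hs) hG⟩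
    · rw [hc, sub_sub_cancel]
      exact ⟨hs2, mul_neg_of_pos_of_neg hs hG⟩

end

theorem proposition3p4 (a b γ γt : ℝ) (ha : 0 < a) (hb : 0 < b) :
    (∀ k : ℝ, 0 < k →
      (k ^ 2 ∈ bandSet a b γ γt ↔
        (BCPlus a b γ γt k ∧ 0 < bandG a γ γt k) ∨
        (BCMinus a b γ γt k ∧ bandG a γ γt k < 0))) ∧
    (∀ κ : ℝ, 0 < κ →
      (-κ ^ 2 ∈ bandSet a b γ γt ↔
        (BCPlusNeg a b γ γt κ ∧ 0 < bandGNeg a γ γt κ) ∨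
        (BCMinusNeg a b γ γt κ ∧ bandGNeg a γ γt κ < 0))) := by
  constructor
  · intro k hk
    rw [(IsFundamentalSystem.cos_sin hk.ne').mem_bandSet_iff ha hb γ γt
      (G := bandG a γ γt k) (by rw [bandG]; ring), exists_band_parameter_iff, and_or_left,
      ← and_assoc, ← and_assoc]
    have hS : Real.sin (k * b) / k ≠ 0 ↔ Real.sin (k * b) ≠ 0 := by simp [hk.ne']
    rw [hS]
    -- If `sin (k b)` vanishes, both sides are false, as each band condition includes its being
    -- nonzero.
    by_cases hb0 : Real.sin (k * b) = 0
    · simp [BCPlus, BCMinus, hb0]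
    have hA : Real.cos (k * a) + Real.sin (k * a) / k * Real.cos (k * b) / (Real.sin (k * b) / k) +
        γ * (Real.sin (k * a) / k) / 2 =
        Real.sin (k * (a + b)) / Real.sin (k * b) + γ * Real.sin (k * a) / (2 * k) := by
      rw [mul_add, Real.sin_add]
      field_simp
      ring
    have hρ : Real.sin (k * a) / k / (Real.sin (k * b) / k) =
        Real.sin (k * a) / Real.sin (k * b) := div_div_div_cancel_right₀ hk.ne' _ _
    rw [hA, hρ]
    rfl
  · intro κ hκ
    have hb0 : 0 < Real.sinh (κ * b) := Real.sinh_pos_iff.2 (by positivity)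
    have ha0 : 0 < Real.sinh (κ * a) := Real.sinh_pos_iff.2 (by positivity)
    rw [(IsFundamentalSystem.cosh_sinh hκ.ne').mem_bandSet_iff ha hb γ γt
      (G := bandGNeg a γ γt κ) (by rw [bandGNeg]; ring), exists_band_parameter_iff,
      and_iff_right (by positivity)]
    have hA : Real.cosh (κ * a) +
        Real.sinh (κ * a) / κ * Real.cosh (κ * b) / (Real.sinh (κ * b) / κ) +
        γ * (Real.sinh (κ * a) / κ) / 2 =
        Real.sinh (κ * (a + b)) / Real.sinh (κ * b) + γ * Real.sinh (κ * a) / (2 * κ) := by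
      rw [mul_add, Real.sinh_add]
      field_simp
      ring
    have hρ : Real.sinh (κ * a) / κ / (Real.sinh (κ * b) / κ) =
        Real.sinh (κ * a) / Real.sinh (κ * b) := div_div_div_cancel_right₀ hκ.ne' _ _
    rw [hA, hρ, abs_of_pos (div_pos ha0 hb0)]
    rfl
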